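/- \textbf{Proposition ($\hbar$-$B$KP solution criterion).} Let $R$ be a commutative $\mathbb C$-algebra (for instance $\mathbb C((\hbar))$), let $\hbar\in R$ be invertible, and let $t=(t_1,t_3,t_5,\dots)$. Put $\xi(t,z)=\sum_{j\ \mathrm{odd}}t_jz^j$. \emph{$Q$-Schur polynomials.} Define $P_{n,m}(t)$ by $$\sum_{n,m\ge0}P_{n,m}(t)z_1^nz_2^m=\Bigl(e^{2\xi(t,z_1)+2\xi(t,z_2)}-1\Bigr)\frac{z_1-z_2}{z_1+z_2}.$$ A strict partition $\lambda=[\lambda_1>\dots>\lambda_\ell>0]$ has $Q_\lambda(t)=2^{-\ell/2}\,\mathrm{Pf}\bigl(P_{\lambda_i,\lambda_j}(t)\bigr)$, where a last part $0$ is added to $\lambda$ if $\ell$ is odd. \emph{Hierarchy.} A series $\tau(t)\in R[[t]]$ satisfies the $B$KP hierarchy if $$\oint\frac{dk}{2\pi i\,k}\,e^{\xi(t-t',k)}\,\tau\bigl(t-2[k^{-1}]\bigr)\,\tau\bigl(t'+2[k^{-1}]\bigr)=\tau(t)\,\tau(t'),$$ where $t\pm2[k^{-1}]=(t_1\pm2k^{-1},\,t_3\pm\tfrac23k^{-3},\,\dots)$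 and $\oint\frac{dk}{2\pi i}$ takes the coefficient of $k^{-1}$ in the expansion at $k=\infty$. The $\hbar$-$B$KP hierarchy is the $B$KP hierarchy with times rescaled $t_k\to t_k/\hbar$, that is, $\tau(t)$ satisfies it if $\tau(\hbar t)$ satisfies the $B$KP hierarchy. \emph{Plücker relations.} For a family $C=(C_\lambda)$ in $R$ indexed by strict partitions, and a finite set $S$ of nonnegative integers, let $C_S=C_\lambda$, where the parts of $\lambda$ are the nonzero elements of $S$. The family satisfies the classical $B$KP Plücker relations if for all finite sets $A,B\subset\mathbb Z_{\ge0}$ of odd cardinality, with $A\,\triangle\,B=\{d_1>d_2>\dots>d_r\}$, $$\sum_{i=1}^{r}(-1)^{i-1}\,C_{A\triangle\{d_i\}}\,C_{B\triangle\{d_i\}}=0 .$$ It satisfies the four-term relations if $$C_{\alpha}C_{\alpha\cup\{\beta_1,\beta_2,\beta_3,\beta_4\}}-C_{\alpha\cup\{\beta_1,\beta_2\}}C_{\alpha\cup\{\beta_3,\beta_4\}}+C_{\alpha\cup\{\beta_1,\beta_3\}}C_{\alpha\cup\{\beta_2,\beta_4\}}-C_{\alpha\cup\{\beta_1,\beta_4\}}C_{\alpha\cup\{\beta_2,\beta_3\}}=0$$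 for all strict partitions $\alpha$ and all $\beta_1>\beta_2>\beta_3>\beta_4\ge0$ that are not parts of $\alpha$. \emph{Claim.} For every family $C^\hbar=(C^\hbar_\lambda)$ in $R$, the series $$\tau^\hbar(t)=\sum_{\lambda}C^\hbar_\lambda\,Q_\lambda\!\left(\frac{t}{2\hbar}\right),$$ summed over all strict partitions, satisfies the $\hbar$-$B$KP hierarchy if and only if $C^\hbar$ satisfies the classical $B$KP Plücker relations. In that case $C^\hbar$ satisfies the four-term relations. If no $C^\hbar_\lambda$ is a zero divisor in $R$ (in particular $C^\hbar_\lambda\neq0$ when $R\ne0$), then conversely the four-term relations imply that $\tau^\hbar$ satisfies the $\hbar$-$B$KP hierarchy. -/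

import Mathlib

noncomputable section

namespace BKP

/-! ### Times and the exponential generating functions

The variable with index `i : ℕ` is the time `t_{2i+1}`, of weight `2i+1`. -/

/-- `ξ(t, z) = ∑_{j odd} t_j z^j`, as a power series in `z`. -/
def xi : PowerSeries (MvPolynomial ℕ ℂ) :=
  PowerSeries.mk fun n => if Odd n then MvPolynomial.X (n / 2) else 0

/-- The exponential `e^f` of a formal power series `f` without constant term. -/
def expSeries (f : PowerSeries (MvPolynomial ℕ ℂ)) : PowerSeries (MvPolynomial ℕ ℂ) :=
  (PowerSeries.exp (MvPolynomial ℕ ℂ)).subst f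

/-- `h_n(t)`, defined by `e^{ξ(t, z)} = ∑ h_n(t) z^n`. -/
def h (n : ℕ) : MvPolynomial ℕ ℂ := PowerSeries.coeff n (expSeries xi)

/-- `q_n(t)`, defined by `e^{2 ξ(t, z)} = ∑ q_n(t) z^n`. -/
def q (n : ℕ) : MvPolynomial ℕ ℂ := PowerSeries.coeff n (expSeries ((2 : ℂ) • xi))

/-! ### `Q`-Schur polynomials -/

/-- `P_{n,m}(t)`: the coefficient of `z₁ⁿ z₂ᵐ` in
`(e^{2ξ(t,z₁) + 2ξ(t,z₂)} - 1) (z₁ - z₂) / (z₁ + z₂)`, the quotient being expanded in powers of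
`z₂ / z₁`. See `P_generating` for the generating function identity. -/
def P (n m : ℕ) : MvPolynomial ℕ ℂ :=
  q n * q m + 2 * ∑ i ∈ Finset.Icc 1 m, (-1) ^ i * q (n + i) * q (m - i)
    - if n = 0 ∧ m = 0 then 1 else 0

/-- The Pfaffian of the skew-symmetric matrix with entries `a x y`, with rows and columns labelled
by the entries of a list, by expansion along the first row. (It is `0` for lists of odd length.) -/
def pf {S : Type*} [CommRing S] (a : ℕ → ℕ → S) : List ℕ → S
  | [] => 1
  | x :: l => ∑ i : Fin l.length, (-1) ^ (i : ℕ) * a x (l.get i) * pf a (l.eraseIdx i)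
termination_by l => l.length
decreasing_by
  have := i.isLt
  simp [List.length_eraseIdx]

/-- A strict partition, given as the finite set of its (distinct, positive) parts. -/
def StrictPartition : Type := {s : Finset ℕ // 0 ∉ s}

/-- The size `|λ|`. -/
def StrictPartition.size (l : StrictPartition) : ℕ := ∑ i ∈ l.1, i

/-- The strict partition with the nonzero elements of `s` as parts. -/
def drop0 (s : Finset ℕ) : StrictPartition := ⟨s.erase 0, Finset.notMem_erase 0 s⟩

/-- The parts of `λ` in decreasing order, followed by one zero if their number is odd. -/
def StrictPartition.rows (l : StrictPartition) : List ℕ :=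
  l.1.sort (· ≥ ·) ++ if Odd l.1.card then [0] else []

/-- `Q_λ(t) = 2^{-ℓ(λ)/2} Pf (P_{λᵢ,λⱼ}(t))`. -/
def Q (l : StrictPartition) : MvPolynomial ℕ ℂ :=
  MvPolynomial.C (((Real.sqrt 2 : ℝ) : ℂ)⁻¹ ^ l.1.card) * pf P l.rows

variable {R : Type*} [CommRing R] [Algebra ℂ R]

/-- `Q_λ(c t)` for a scalar `c`: every time `t_k` is replaced by `c t_k`. -/
def Qat (c : R) (l : StrictPartition) : MvPolynomial ℕ R :=
  MvPolynomial.aeval (fun i => MvPolynomial.C c * MvPolynomial.X i) (Q l)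

/-- The formal power series `∑_λ C_λ Q_λ(c t)`, summed coefficientwise. Each coefficient receives
only finitely many contributions, see `finite_support_tauSeries`. -/
def tauSeries (c : R) (C : StrictPartition → R) : MvPowerSeries ℕ R :=
  fun d => ∑ᶠ l : StrictPartition, C l * (Qat c l).coeff d

/-- `τ^ħ(t) = ∑_λ C_λ Q_λ(t / (2ħ))`. -/
def tauHbar (ħ : Rˣ) (C : StrictPartition → R) : MvPowerSeries ℕ R :=
  tauSeries (algebraMap ℂ R (1 / 2) * ((ħ⁻¹ : Rˣ) : R)) C

/-! ### The hierarchy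

The variables `Sum.inl i`, `Sum.inr i` are `t_{2i+1}` and `t'_{2i+1}`; in the ring with variables
indexed by `Option (ℕ ⊕ ℕ)` the additional variable `none` is `k⁻¹`. -/

/-- `t - 2[k⁻¹]`. -/
def shiftLeft (i : ℕ) : MvPowerSeries (Option (ℕ ⊕ ℕ)) R :=
  MvPowerSeries.X (some (Sum.inl i))
    - MvPowerSeries.C (algebraMap ℂ R (2 / (2 * i + 1))) * MvPowerSeries.X none ^ (2 * i + 1)

/-- `t' + 2[k⁻¹]`. -/
def shiftRight (i : ℕ) : MvPowerSeries (Option (ℕ ⊕ ℕ)) R :=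
  MvPowerSeries.X (some (Sum.inr i))
    + MvPowerSeries.C (algebraMap ℂ R (2 / (2 * i + 1))) * MvPowerSeries.X none ^ (2 * i + 1)

/-- `τ(t - 2[k⁻¹]) τ(t' + 2[k⁻¹])`. -/
def shiftedProduct (τ : MvPowerSeries ℕ R) : MvPowerSeries (Option (ℕ ⊕ ℕ)) R :=
  τ.subst (shiftLeft (R := R)) * τ.subst (shiftRight (R := R))

/-- The coefficient of `k^{-n}` in `τ(t - 2[k⁻¹]) τ(t' + 2[k⁻¹])`, a power series in `t, t'`. -/
def shiftedProductCoeff (τ : MvPowerSeries ℕ R) (n : ℕ) : MvPowerSeries (ℕ ⊕ ℕ) R :=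
  fun d => (shiftedProduct τ).coeff (d.mapDomain some + Finsupp.single none n)

/-- The coefficient `h_n(t - t')` of `k^n` in `e^{ξ(t - t', k)}`. -/
def hDiff (R : Type*) [CommRing R] [Algebra ℂ R] (n : ℕ) : MvPolynomial (ℕ ⊕ ℕ) R :=
  MvPolynomial.aeval
    (fun i => MvPolynomial.X (Sum.inl i) - MvPolynomial.X (Sum.inr i)) (h n)

/-- The coefficient of `k^{-1}` in `k⁻¹ e^{ξ(t - t', k)} τ(t - 2[k⁻¹]) τ(t' + 2[k⁻¹])`, that is
`∑ₙ [k^n] e^{ξ(t - t', k)} · [k^{-n}] τ(t - 2[k⁻¹]) τ(t' + 2[k⁻¹])`, summed coefficientwise.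
Each coefficient receives only finitely many contributions, see `finite_support_residue`. -/
def residue (τ : MvPowerSeries ℕ R) : MvPowerSeries (ℕ ⊕ ℕ) R :=
  fun d => ∑ᶠ n : ℕ,
    ((hDiff R n : MvPowerSeries (ℕ ⊕ ℕ) R) * shiftedProductCoeff τ n).coeff d

/-- `τ` is a tau-function of the `B`KP hierarchy: the Hirota bilinear identity
`∮ dk/(2πik) e^{ξ(t - t', k)} τ(t - 2[k⁻¹]) τ(t' + 2[k⁻¹]) = τ(t) τ(t')`. -/
def IsBKP (τ : MvPowerSeries ℕ R) : Prop :=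
  residue τ = MvPowerSeries.rename (Function.Embedding.inl : ℕ ↪ ℕ ⊕ ℕ) τ
    * MvPowerSeries.rename (Function.Embedding.inr : ℕ ↪ ℕ ⊕ ℕ) τ

/-- The `ħ`-`B`KP hierarchy is the `B`KP hierarchy in the rescaled times `t_k / ħ`: `τ` is a
solution if `t ↦ τ(ħ t)` is a solution of the `B`KP hierarchy. -/
def IsHbarBKP (ħ : Rˣ) (τ : MvPowerSeries ℕ R) : Prop :=
  IsBKP (MvPowerSeries.rescale (fun _ => (ħ : R)) τ)

/-! ### Plücker relations -/

/-- The `B`KP Plücker relations: for all finite sets `A`, `B` of nonnegative integers of odd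
cardinality, with `A ∆ B = {d₁ > d₂ > ⋯}`, one has `∑ᵢ (-1)^{i-1} C_{A ∆ dᵢ} C_{B ∆ dᵢ} = 0`.
Here the subscripts are sets of even cardinality, and a zero in them is dropped. -/
def PluckerRelations (C : StrictPartition → R) : Prop :=
  ∀ A B : Finset ℕ, Odd A.card → Odd B.card →
    ∑ i ∈ symmDiff A B, (-1) ^ ((symmDiff A B).filter (i < ·)).card
      * C (drop0 (symmDiff A {i})) * C (drop0 (symmDiff B {i})) = 0

/-- The four-term `B`KP Plücker relations
`C_{[α]} C_{[α,β₁,β₂,β₃,β₄]} - C_{[α,β₁,β₂]} C_{[α,β₃,β₄]} + C_{[α,β₁,β₃]} C_{[α,β₂,β₄]}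
- C_{[α,β₁,β₄]} C_{[α,β₂,β₃]} = 0`, where `β₄` may be zero and a zero is dropped. -/
def FourTermRelations (C : StrictPartition → R) : Prop :=
  ∀ (α : StrictPartition) (b₁ b₂ b₃ b₄ : ℕ), b₄ < b₃ → b₃ < b₂ → b₂ < b₁ →
    b₁ ∉ α.1 → b₂ ∉ α.1 → b₃ ∉ α.1 → b₄ ∉ α.1 →
      C α * C (drop0 (α.1 ∪ {b₁, b₂, b₃, b₄}))
        - C (drop0 (α.1 ∪ {b₁, b₂})) * C (drop0 (α.1 ∪ {b₃, b₄}))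
        + C (drop0 (α.1 ∪ {b₁, b₃})) * C (drop0 (α.1 ∪ {b₂, b₄}))
        - C (drop0 (α.1 ∪ {b₁, b₄})) * C (drop0 (α.1 ∪ {b₂, b₃})) = 0


/-! ### Well-definedness of the sums and substitutions above -/

theorem hasSubst_xi (c : ℂ) : PowerSeries.HasSubst (c • xi) := by
  apply PowerSeries.HasSubst.of_constantCoeff_zero'
  simp [xi, ← PowerSeries.coeff_zero_eq_constantCoeff_apply]

/-- The weight `2i+1` of the time `t_{2i+1}`. -/
def wt (i : ℕ) : ℕ := 2 * i + 1

open MvPolynomial in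
theorem coeff_xi_pow_homog (r n : ℕ) :
    IsWeightedHomogeneous wt (PowerSeries.coeff n (xi ^ r)) n := by
  induction r generalizing n with
  | zero =>
    rw [pow_zero, PowerSeries.coeff_one]
    split_ifs with hn
    · subst hn; exact isWeightedHomogeneous_one _ _
    · exact isWeightedHomogeneous_zero _ _ _
  | succ r ih =>
    rw [pow_succ, PowerSeries.coeff_mul]
    refine IsWeightedHomogeneous.sum _ _ _ fun x hx => ?_
    rw [← Finset.HasAntidiagonal.mem_antidiagonal.mp hx]
    refine (ih x.1).mul ?_
    rw [xi, PowerSeries.coeff_mk]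
    split_ifs with ho
    · have := isWeightedHomogeneous_X ℂ wt (x.2 / 2)
      have h2 : wt (x.2 / 2) = x.2 := by
        obtain ⟨k, hk⟩ := ho
        unfold wt; omega
      rwa [h2] at this
    · exact isWeightedHomogeneous_zero _ _ _

open MvPolynomial in
theorem coeff_expSeries_homog (c : ℂ) (n : ℕ) :
    IsWeightedHomogeneous wt (PowerSeries.coeff n (expSeries (c • xi))) n := by
  rw [expSeries, PowerSeries.coeff_subst' (hasSubst_xi c)]
  refine finsum_induction (fun f => IsWeightedHomogeneous wt f n)
    (isWeightedHomogeneous_zero _ _ _) (fun _ _ hf hg => hf.add hg) fun r => ?_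
  have h1 : PowerSeries.coeff r (PowerSeries.exp (MvPolynomial ℕ ℂ))
      = C (algebraMap ℚ ℂ (1 / (r.factorial : ℚ))) := by
    rw [PowerSeries.coeff_exp, IsScalarTower.algebraMap_apply ℚ ℂ (MvPolynomial ℕ ℂ), algebraMap_eq]
  rw [h1, smul_pow, PowerSeries.coeff_smul, smul_eq_mul, smul_eq_C_mul]
  exact ((coeff_xi_pow_homog r n).C_mul _).C_mul _

open MvPolynomial in
theorem aeval_homog {σ' : Type*} {S : Type*} [CommRing S] [Algebra ℂ S] (w' : σ' → ℕ)
    (g : ℕ → MvPolynomial σ' S) (hg : ∀ i, IsWeightedHomogeneous w' (g i) (wt i))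
    {f : MvPolynomial ℕ ℂ} {n : ℕ} (hf : IsWeightedHomogeneous wt f n) :
    IsWeightedHomogeneous w' (aeval g f) n := by
  rw [aeval_def, eval₂_eq]
  refine IsWeightedHomogeneous.sum _ _ _ fun d hd => ?_
  have hd' := hf (mem_support_iff.mp hd)
  rw [IsScalarTower.algebraMap_apply ℂ S (MvPolynomial σ' S), algebraMap_eq]
  refine IsWeightedHomogeneous.C_mul ?_ _
  rw [← hd', Finsupp.weight_apply, Finsupp.sum]
  exact IsWeightedHomogeneous.prod _ _ _ fun i _ => (hg i).pow _

open MvPolynomial in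
theorem q_homog (n : ℕ) : IsWeightedHomogeneous wt (q n) n := coeff_expSeries_homog 2 n

open MvPolynomial in
theorem h_homog (n : ℕ) : IsWeightedHomogeneous wt (h n) n := by
  have := coeff_expSeries_homog 1 n
  rwa [one_smul] at this

open MvPolynomial in
theorem P_homog (n m : ℕ) : IsWeightedHomogeneous wt (P n m) (n + m) := by
  unfold P
  refine ((((q_homog n).mul (q_homog m)).add ?_)).sub ?_
  · have h2 : (2 : MvPolynomial ℕ ℂ) = C 2 := (map_ofNat C 2).symm
    rw [h2]
    refine IsWeightedHomogeneous.C_mul ?_ _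
    refine IsWeightedHomogeneous.sum _ _ _ fun i hi => ?_
    have h3 : ((-1) ^ i : MvPolynomial ℕ ℂ) = C ((-1) ^ i) := by simp
    rw [h3]
    have := (((q_homog (n + i)).C_mul ((-1) ^ i)).mul (q_homog (m - i)))
    rwa [show n + i + (m - i) = n + m by have := Finset.mem_Icc.mp hi; omega] at this
  · split_ifs with hh
    · rw [hh.1, hh.2]; exact isWeightedHomogeneous_one _ _
    · exact isWeightedHomogeneous_zero _ _ _

open MvPolynomial in
theorem pf_homog (l : List ℕ) : IsWeightedHomogeneous wt (pf P l) l.sum := by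
  induction hn : l.length using Nat.strong_induction_on generalizing l with
  | _ n ih =>
    subst hn
    cases l with
    | nil => rw [pf]; exact isWeightedHomogeneous_one _ _
    | cons x l =>
      rw [pf]
      refine IsWeightedHomogeneous.sum _ _ _ fun i _ => ?_
      have h3 : ((-1) ^ (i : ℕ) : MvPolynomial ℕ ℂ) = C ((-1) ^ (i : ℕ)) := by simp
      rw [h3]
      have h4 := ih (l.eraseIdx i).length (by
        have := i.isLt
        rw [List.length_eraseIdx, List.length_cons]; split_ifs; omega) _ rfl
      have h5 := ((P_homog x (l.get i)).C_mul ((-1) ^ (i : ℕ))).mul h4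
      have h6 : l.get i + (l.eraseIdx i).sum = l.sum := by
        have := (List.getElem_cons_eraseIdx_perm i.isLt).sum_eq
        simpa only [List.sum_cons, List.get_eq_getElem] using this
      rwa [add_assoc, h6, ← List.sum_cons] at h5

open MvPolynomial in
/-- `Q_λ` is homogeneous of degree `|λ|` if `t_k` has degree `k`. -/
theorem Q_homog (l : StrictPartition) : IsWeightedHomogeneous wt (Q l) l.size := by
  unfold Q
  refine IsWeightedHomogeneous.C_mul ?_ _
  have h1 := pf_homog l.rows
  have h2 : l.rows.sum = l.size := by
    unfold StrictPartition.rows StrictPartition.size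
    have h3 : (l.1.sort (· ≥ ·)).sum = ∑ i ∈ l.1, i := by
      rw [← Multiset.sum_coe, Finset.sort_eq, Finset.sum, Multiset.map_id']
    split_ifs <;> simp [h3]
  rwa [h2] at h1

theorem finite_size (n : ℕ) : {l : StrictPartition | l.size = n}.Finite := by
  refine Set.Finite.of_injOn (f := fun l : StrictPartition => l.1)
    (t := ↑(Finset.range (n + 1)).powerset) ?_ (fun a _ b _ h => Subtype.ext h)
    (Finset.finite_toSet _)
  intro l hl
  simp only [Finset.coe_powerset, Set.mem_preimage, Set.mem_powerset_iff]
  intro i hi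
  have h1 : i ≤ ∑ j ∈ l.1, j := Finset.single_le_sum (f := fun j => j) (by simp) hi
  have h2 : ∑ j ∈ l.1, j = n := hl
  simp; omega

open MvPolynomial in
theorem finite_support_tauSeries {R : Type*} [CommRing R] [Algebra ℂ R] (c : R)
    (C : StrictPartition → R) (d : ℕ →₀ ℕ) :
    (Function.support fun l : StrictPartition => C l * (Qat c l).coeff d).Finite := by
  refine (finite_size (Finsupp.weight wt d)).subset fun l hl => ?_
  have h1 : IsWeightedHomogeneous wt (Qat c l) l.size :=
    aeval_homog wt _ (fun i => (isWeightedHomogeneous_X R wt i).C_mul c) (Q_homog l)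
  have h2 : (Qat c l).coeff d ≠ 0 := fun h0 => hl (by simp [h0])
  exact (h1 h2).symm

open MvPolynomial in
theorem hDiff_homog (R : Type*) [CommRing R] [Algebra ℂ R] (n : ℕ) :
    IsWeightedHomogeneous (Sum.elim wt wt) (hDiff R n) n :=
  aeval_homog _ _ (fun i => (isWeightedHomogeneous_X R (Sum.elim wt wt) (Sum.inl i)).sub
    (isWeightedHomogeneous_X R (Sum.elim wt wt) (Sum.inr i))) (h_homog n)

theorem finite_support_residue {R : Type*} [CommRing R] [Algebra ℂ R] (τ : MvPowerSeries ℕ R)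
    (d : ℕ ⊕ ℕ →₀ ℕ) :
    (Function.support fun n : ℕ =>
      ((hDiff R n : MvPowerSeries (ℕ ⊕ ℕ) R) * shiftedProductCoeff τ n).coeff d).Finite := by
  classical
  refine (Set.finite_Iic (Finsupp.weight (Sum.elim wt wt) d)).subset fun n hn => ?_
  rw [Function.mem_support, MvPowerSeries.coeff_mul] at hn
  obtain ⟨x, hx, hx0⟩ := Finset.exists_ne_zero_of_sum_ne_zero hn
  have h1 : (hDiff R n).coeff x.1 ≠ 0 := fun h0 => hx0 (by simp [h0])
  have h2 := hDiff_homog R n h1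
  rw [Set.mem_Iic, ← Finset.HasAntidiagonal.mem_antidiagonal.mp hx, map_add, h2]
  exact Nat.le_add_right _ _

theorem hasSubst_shift {R : Type*} [CommRing R] (f : ℕ → ℕ ⊕ ℕ) (hf : Function.Injective f)
    (c : ℕ → R) : MvPowerSeries.HasSubst fun i : ℕ =>
      (MvPowerSeries.X (some (f i)) + MvPowerSeries.C (c i) * MvPowerSeries.X none ^ (2 * i + 1) :
        MvPowerSeries (Option (ℕ ⊕ ℕ)) R) where
  const_coeff i := by simp
  coeff_zero d := by
    classical
    refine Set.Finite.subset (s := {i | d = Finsupp.single (some (f i)) 1} ∪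
      {i | d = Finsupp.single none (2 * i + 1)}) ?_ ?_
    · refine Set.Finite.union (Set.Subsingleton.finite ?_) (Set.Subsingleton.finite ?_)
      · intro i hi j hj
        have := hi.symm.trans hj
        rw [Finsupp.single_left_inj one_ne_zero] at this
        exact hf (Option.some.inj this)
      · intro i hi j hj
        have := Finsupp.single_injective _ (hi.symm.trans hj)
        omega
    · intro i hi
      by_contra hcon
      simp only [Set.mem_union, Set.mem_ofPred_eq, not_or] at hcon
      apply hi
      rw [map_add, MvPowerSeries.coeff_X, MvPowerSeries.coeff_C_mul, MvPowerSeries.coeff_X_pow,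
        if_neg hcon.1, if_neg hcon.2]
      simp

theorem hasSubst_shiftLeft {R : Type*} [CommRing R] [Algebra ℂ R] :
    MvPowerSeries.HasSubst (shiftLeft (R := R)) := by
  have := hasSubst_shift Sum.inl Sum.inl_injective
    fun i : ℕ => -(algebraMap ℂ R (2 / (2 * i + 1)))
  convert this using 2 with i
  simp [shiftLeft, sub_eq_add_neg]

theorem hasSubst_shiftRight {R : Type*} [CommRing R] [Algebra ℂ R] :
    MvPowerSeries.HasSubst (shiftRight (R := R)) :=
  hasSubst_shift Sum.inr Sum.inr_injective fun i : ℕ => algebraMap ℂ R (2 / (2 * i + 1))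

theorem expSeries_mul_neg (m : ℕ) :
    ∑ x ∈ Finset.HasAntidiagonal.antidiagonal m, q x.1 * ((-1) ^ x.2 * q x.2) = if m = 0 then 1 else 0 := by
  have hs := hasSubst_xi 2
  have hX : PowerSeries.HasSubst ((-1 : MvPolynomial ℕ ℂ) • PowerSeries.X :
      PowerSeries (MvPolynomial ℕ ℂ)) := PowerSeries.HasSubst.smul_X' _
  have hodd : PowerSeries.subst ((-1 : MvPolynomial ℕ ℂ) • PowerSeries.X :
      PowerSeries (MvPolynomial ℕ ℂ)) ((2 : ℂ) • xi) = -((2 : ℂ) • xi) := by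
    rw [← PowerSeries.rescale_eq_subst]
    ext1 n
    rw [PowerSeries.coeff_rescale, map_neg, PowerSeries.coeff_smul, xi, PowerSeries.coeff_mk]
    split_ifs with hn
    · rw [hn.neg_one_pow]; simp
    · simp
  have h1 : PowerSeries.rescale (-1) (expSeries ((2 : ℂ) • xi)) =
      (PowerSeries.evalNegHom (PowerSeries.exp (MvPolynomial ℕ ℂ))).subst ((2 : ℂ) • xi) := by
    rw [PowerSeries.evalNegHom, PowerSeries.rescale_eq_subst, PowerSeries.rescale_eq_subst,
      expSeries, PowerSeries.subst_comp_subst_apply hs hX, PowerSeries.subst_comp_subst_apply hX hs,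
      hodd, PowerSeries.subst_smul hs, PowerSeries.subst_X hs]
    simp
  have h2 : expSeries ((2 : ℂ) • xi) * PowerSeries.rescale (-1) (expSeries ((2 : ℂ) • xi)) = 1 := by
    rw [h1, expSeries, ← PowerSeries.subst_mul hs, PowerSeries.exp_mul_exp_neg_eq_one]
    rw [← map_one (PowerSeries.C (R := MvPolynomial ℕ ℂ)), PowerSeries.subst_C]
    simp
  have h3 := congrArg (PowerSeries.coeff m) h2
  rw [PowerSeries.coeff_mul, PowerSeries.coeff_one] at h3
  rw [← h3]
  refine Finset.sum_congr rfl fun x _ => ?_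
  rw [PowerSeries.coeff_rescale]; rfl

theorem q_zero : q 0 = 1 := by
  have h1 := expSeries_mul_neg 0
  have h2 : PowerSeries.constantCoeff (expSeries ((2 : ℂ) • xi)) = 1 := by
    rw [expSeries, ← PowerSeries.coeff_zero_eq_constantCoeff_apply,
      PowerSeries.coeff_subst' (hasSubst_xi 2), finsum_eq_single _ 0]
    · simp
    · intro n hn
      have h3 : PowerSeries.constantCoeff ((2 : ℂ) • xi) = 0 := by
        simp [xi, ← PowerSeries.coeff_zero_eq_constantCoeff_apply]
      rw [PowerSeries.coeff_zero_eq_constantCoeff_apply, map_pow, h3, zero_pow hn, smul_zero]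
  rw [q, PowerSeries.coeff_zero_eq_constantCoeff_apply, h2]

theorem P_add (n m : ℕ) : P n (m + 1) + P (n + 1) m = q n * q (m + 1) - q (n + 1) * q m := by
  have h1 : ∑ i ∈ Finset.Icc 1 (m + 1), (-1) ^ i * q (n + i) * q (m + 1 - i) =
      -(q (n + 1) * q m) - ∑ i ∈ Finset.Icc 1 m, (-1) ^ i * q (n + 1 + i) * q (m - i) := by
    rw [← Finset.Ico_add_one_right_eq_Icc, ← Finset.Ico_add_one_right_eq_Icc,
      Finset.sum_eq_sum_Ico_succ_bot (by omega), ← Finset.sum_Ico_add' _ 1 (m + 1) 1]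
    rw [sub_eq_add_neg, ← Finset.sum_neg_distrib]
    congr 1
    · simp
    · refine Finset.sum_congr rfl fun i _ => ?_
      rw [show n + (i + 1) = n + 1 + i by ring, show m + 1 - (i + 1) = m - i by omega]
      ring
  unfold P
  rw [h1]
  simp
  ring

theorem P_right (n : ℕ) : P n 0 = q n - if n = 0 then 1 else 0 := by
  simp [P, q_zero]

theorem P_left (m : ℕ) : P 0 m = -(q m - if m = 0 then 1 else 0) := by
  rcases Nat.eq_zero_or_pos m with rfl | hm
  · simp [P, q_zero]
  have h1 := expSeries_mul_neg m
  rw [if_neg hm.ne', Finset.Nat.sum_antidiagonal_swap.symm,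
    Finset.Nat.sum_antidiagonal_eq_sum_range_succ_mk,
    Finset.range_eq_Ico, Finset.sum_eq_sum_Ico_succ_bot (by omega),
    Nat.succ_eq_add_one, Finset.Ico_add_one_right_eq_Icc] at h1
  have h2 : ∑ i ∈ Finset.Icc 1 m, (-1) ^ i * q (0 + i) * q (m - i) = -q m := by
    rw [eq_neg_iff_add_eq_zero, ← h1, add_comm]
    congr 1
    · simp [q_zero]
    · refine Finset.sum_congr (by simp) fun i _ => ?_
      simp only [Prod.swap, zero_add]; ring
  unfold P
  rw [h2]
  simp [q_zero, hm.ne']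
  ring

theorem coeff_X_mul' (s : Fin 2) (f : MvPowerSeries (Fin 2) (MvPolynomial ℕ ℂ)) (d : Fin 2 →₀ ℕ) :
    MvPowerSeries.coeff d (MvPowerSeries.X s * f) =
      if d s = 0 then 0 else MvPowerSeries.coeff (d - Finsupp.single s 1) f := by
  rw [MvPowerSeries.X_def, MvPowerSeries.coeff_monomial_mul, one_mul]
  simp only [Finsupp.single_le_iff, Nat.one_le_iff_ne_zero]
  split_ifs <;> simp_all

/-- `∑ P_{n,m}(t) z₁ⁿ z₂ᵐ`. -/
def PSeries : MvPowerSeries (Fin 2) (MvPolynomial ℕ ℂ) := fun d => P (d 0) (d 1)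

/-- `e^{2ξ(t,z₁)} e^{2ξ(t,z₂)} = ∑ q_n(t) q_m(t) z₁ⁿ z₂ᵐ`. -/
def qqSeries : MvPowerSeries (Fin 2) (MvPolynomial ℕ ℂ) := fun d => q (d 0) * q (d 1)

/-- `(z₁ + z₂) ∑ P_{n,m} z₁ⁿ z₂ᵐ = (z₁ - z₂) (e^{2ξ(t,z₁)} e^{2ξ(t,z₂)} - 1)`. -/
theorem P_generating :
    (MvPowerSeries.X 0 + MvPowerSeries.X 1) * PSeries =
      (MvPowerSeries.X 0 - MvPowerSeries.X 1) * (qqSeries - 1) := by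
  classical
  ext1 d
  rw [add_mul, sub_mul, map_add, map_sub, coeff_X_mul', coeff_X_mul', coeff_X_mul', coeff_X_mul']
  simp only [map_sub, MvPowerSeries.coeff_one]
  simp only [PSeries, qqSeries, MvPowerSeries.coeff_apply, Finsupp.tsub_apply, Finsupp.ext_iff, Fin.forall_fin_two,
    Finsupp.coe_zero, Pi.zero_apply, Finsupp.single_apply]
  simp only [if_true, Fin.isValue, zero_ne_one, one_ne_zero, if_false, Nat.sub_zero]
  generalize d 0 = n
  generalize d 1 = m
  rcases n with _ | n <;> rcases m with _ | m
  · simp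
  · simp [P_left, q_zero]
  · simp [P_right, q_zero]
  · simp only [Nat.add_eq_zero_iff, one_ne_zero, and_false, false_and, if_false, Nat.add_sub_cancel,
      sub_zero]
    exact P_add n m

end BKP

end

/-! Let φ_p (`vop`) be the coefficient of k^p in the vertex operator f ↦ e^{ξ(t,k)} f(t − 2[k⁻¹]).
Only odd times occur, so e^{ξ(t−t',k)} = e^{ξ(t,k)} e^{ξ(t',−k)} and t' + 2[k⁻¹] is the same shift
at −k. Hence for a polynomial f the residue is the finite sum Σ_p (−1)^p φ_p f ⊗ φ_{−p} f
(`residue_coe`).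

The φ_p are neutral fermions. Wick's theorem makes φ_{λ₁}⋯φ_{λ_ℓ}·1 a Pfaffian of the two-point
functions φ_n h_m (`amp`). These obey the recursion of P_{n,m}(t/2), so the word equals 2^{ℓ/2}
Q_λ(t/2). The inductive heart is `shiftHom_fock`. On this basis φ_n inserts the part n, φ_{−n}
removes it, and φ_0 multiplies by the parity sign (`vop_natCast_halfQ`, `vop_neg_halfQ`,
`vop_zero_halfQ`).

The coefficient of Q_s(t/2) Q_t(t'/2) in the bilinear identity is therefore `bilinCoeff`. It is
twice the Plücker expression of s and t after each set of even size has been given the element 0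
(`bilinCoeff_eq`). Annihilation operators show that the products Q_s ⊗ Q_t are linearly independent,
so the hierarchy holds exactly when all Plücker expressions vanish. Homogeneity reduces the infinite
series to polynomials (`agreeTo_tauSeries`, `AgreeTo.residue`), and rescaling the times removes ħ.

The four-term relations are the Plücker relations with a symmetric difference of four elements.
Conversely, if no coefficient is a zero divisor, they determine all coefficients recursively from
those of sets with at most two elements. Pfaffians satisfy the same recursion, so the family is
Pfaffian up to powers of c_∅ (`exists_pf_of_four`), and Pfaffians satisfy every Plücker relation
(`pf_plucker`). -/

noncomputable section

namespace BKP

/-! ### Contraction of functions on lists -/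

section Contraction

variable {S : Type*} [CommRing S]

/-- The signed sum `∑ᵢ (-1)ⁱ u(lᵢ) F(l without its i-th entry)`. -/
def contr (u : ℕ → S) : (List ℕ → S) → List ℕ → S
  | _, [] => 0
  | F, x :: l => u x * F l - contr u (fun l' => F (x :: l')) l

theorem contr_nil (u : ℕ → S) (F : List ℕ → S) : contr u F [] = 0 := rfl

theorem contr_cons (u : ℕ → S) (F : List ℕ → S) (x : ℕ) (l : List ℕ) :
    contr u F (x :: l) = u x * F l - contr u (fun l' => F (x :: l')) l := rfl

/-- The length condition lets identities that hold only for words of one parity be substituted under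
a contraction. -/
theorem contr_congr (u : ℕ → S) {F G : List ℕ → S} {l : List ℕ}
    (h : ∀ l', l'.length + 1 = l.length → F l' = G l') : contr u F l = contr u G l := by
  induction l generalizing F G with
  | nil => rfl
  | cons x l ih =>
    rw [contr_cons, contr_cons, h l rfl]
    congr 1
    exact ih fun l' hl' => h _ (by simp [hl'])

/-- Only additivity of φ is used, and the hypothesis concerns whole products, because `pairing` is
linear but not multiplicative. -/
theorem contr_map {T : Type*} [CommRing T] (φ : S →+ T) {u : ℕ → S} {u' : ℕ → T}
    {F : List ℕ → S} {F' : List ℕ → T} {l : List ℕ}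
    (h : ∀ x ∈ l, ∀ l', l'.length + 1 = l.length → φ (u x * F l') = u' x * F' l') :
    φ (contr u F l) = contr u' F' l := by
  induction l generalizing F F' with
  | nil => simp [contr]
  | cons x l ih =>
    rw [contr_cons, contr_cons, map_sub, h x (by simp) l rfl]
    congr 1
    exact ih fun y hy l' hl' => h y (by simp [hy]) _ (by simp [hl'])

theorem contr_add (u : ℕ → S) (F G : List ℕ → S) (l : List ℕ) :
    contr u (fun l => F l + G l) l = contr u F l + contr u G l := by
  induction l generalizing F G with
  | nil => simp [contr]
  | cons x l ih => rw [contr_cons, contr_cons, contr_cons, ih]; ring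

theorem contr_mul_left (u : ℕ → S) (c : S) (F : List ℕ → S) (l : List ℕ) :
    contr u (fun l => c * F l) l = c * contr u F l := by
  induction l generalizing F with
  | nil => simp [contr]
  | cons x l ih => rw [contr_cons, contr_cons, ih]; ring

theorem contr_neg (u : ℕ → S) (F : List ℕ → S) (l : List ℕ) :
    contr u (fun l => -F l) l = -contr u F l := by
  simpa using contr_mul_left u (-1) F l

theorem contr_sub (u : ℕ → S) (F G : List ℕ → S) (l : List ℕ) :
    contr u (fun l => F l - G l) l = contr u F l - contr u G l := by
  simp only [sub_eq_add_neg, contr_add, contr_neg]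

theorem contr_add_left (u v : ℕ → S) (F : List ℕ → S) (l : List ℕ) :
    contr (fun x => u x + v x) F l = contr u F l + contr v F l := by
  induction l generalizing F with
  | nil => simp [contr]
  | cons x l ih => rw [contr_cons, contr_cons, contr_cons, ih]; ring

theorem contr_mul_left' (u : ℕ → S) (c : S) (F : List ℕ → S) (l : List ℕ) :
    contr (fun x => c * u x) F l = c * contr u F l := by
  induction l generalizing F with
  | nil => simp [contr]
  | cons x l ih => rw [contr_cons, contr_cons, ih]; ring

/-- Contractions anticommute. -/
theorem contr_contr (u v : ℕ → S) (F : List ℕ → S) (l : List ℕ) :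
    contr u (contr v F) l = -contr v (contr u F) l := by
  induction l generalizing F with
  | nil => simp [contr]
  | cons x l ih =>
    simp only [contr_cons, contr_sub, contr_mul_left, ih]
    ring

/-- Anticommutation alone would only show that twice the value vanishes, which is not enough over a
general ring. -/
theorem contr_contr_self (u : ℕ → S) (F : List ℕ → S) (l : List ℕ) :
    contr u (contr u F) l = 0 := by
  induction l generalizing F with
  | nil => simp [contr]
  | cons x l ih =>
    simp only [contr_cons, contr_sub, contr_mul_left, ih]
    ring

theorem contr_append (u : ℕ → S) (F : List ℕ → S) (l₁ l₂ : List ℕ) :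
    contr u F (l₁ ++ l₂) = contr u (fun l => F (l ++ l₂)) l₁
      + (-1) ^ l₁.length * contr u (fun l => F (l₁ ++ l)) l₂ := by
  induction l₁ generalizing F with
  | nil => simp [contr]
  | cons x l₁ ih =>
    simp only [List.cons_append, contr_cons, ih, List.length_cons]
    ring

theorem contr_swap (u : ℕ → S) (F : List ℕ → S) (x y : ℕ) (l₁ l₂ : List ℕ)
    (h : ∀ l₁' l₂', l₁'.length + l₂'.length + 1 = l₁.length + l₂.length →
      F (l₁' ++ x :: y :: l₂') = -F (l₁' ++ y :: x :: l₂')) :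
    contr u F (l₁ ++ x :: y :: l₂) = -contr u F (l₁ ++ y :: x :: l₂) := by
  rw [contr_append, contr_append]
  simp only [contr_cons]
  rw [contr_congr u (F := fun l => F (l ++ x :: y :: l₂)) (G := fun l => -F (l ++ y :: x :: l₂))
      (fun l' hl' => h _ _ (by omega)),
    contr_congr u (F := fun l => F (l₁ ++ x :: y :: l)) (G := fun l => -F (l₁ ++ y :: x :: l))
      (fun l' hl' => h _ _ (by omega)), contr_neg, contr_neg]
  ring

theorem contr_eq_sum (u : ℕ → S) (F : List ℕ → S) (l : List ℕ) :
    contr u F l = ∑ i : Fin l.length, (-1) ^ (i : ℕ) * u (l.get i) * F (l.eraseIdx i) := by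
  induction l generalizing F with
  | nil => simp [contr]
  | cons x l ih =>
    rw [contr_cons, ih]
    simp only [List.length_cons]
    rw [Fin.sum_univ_succ, sub_eq_add_neg, ← Finset.sum_neg_distrib]
    simp [pow_succ]

theorem pf_cons (a : ℕ → ℕ → S) (x : ℕ) (l : List ℕ) :
    pf a (x :: l) = contr (a x) (pf a) l := by
  rw [pf, contr_eq_sum]

theorem pf_nil (a : ℕ → ℕ → S) : pf a [] = 1 := by rw [pf]

end Contraction

/-! ### Decreasingly sorted lists -/

/-- The elements of a finite set in decreasing order. -/
abbrev sortD (s : Finset ℕ) : List ℕ := s.sort (· ≥ ·)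

theorem sortD_insert_max {a : ℕ} {s : Finset ℕ} (h : ∀ x ∈ s, x < a) :
    sortD (insert a s) = a :: sortD s :=
  Finset.sort_insert _ (fun b hb => (h b hb).le) fun ha => lt_irrefl _ (h a ha)

theorem sortD_split (s : Finset ℕ) (x : ℕ) :
    sortD s = sortD (s.filter (x < ·)) ++ sortD (s.filter (¬ x < ·)) := by
  apply List.Perm.eq_of_pairwise (le := (· ≥ ·))
  · intro a b _ _ h1 h2; exact le_antisymm h2 h1
  · exact Finset.pairwise_sort _ _
  · refine List.pairwise_append.mpr ⟨Finset.pairwise_sort _ _, Finset.pairwise_sort _ _, ?_⟩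
    intro a ha b hb
    simp only [Finset.mem_sort, Finset.mem_filter] at ha hb
    omega
  · rw [← Multiset.coe_eq_coe, ← Multiset.coe_add, Finset.sort_eq, Finset.sort_eq, Finset.sort_eq]
    exact (Multiset.filter_add_not _ _).symm

section Sorted

variable {S : Type*} [CommRing S]

/-- The sign with which `x` moves past the larger elements of `s`. -/
def sgn (S : Type*) [CommRing S] (x : ℕ) (s : Finset ℕ) : S := (-1) ^ (s.filter (x < ·)).card

theorem sgn_mul_self (x : ℕ) (s : Finset ℕ) : sgn S x s * sgn S x s = 1 := by
  rw [sgn, ← mul_pow]; simp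

theorem sgn_insert_self (x : ℕ) (s : Finset ℕ) : sgn S x (insert x s) = sgn S x s := by
  rw [sgn, sgn, Finset.filter_insert, if_neg (lt_irrefl x)]

/-- Elements of `s ∩ t` above `x` are counted twice on the right and so do not affect the sign. -/
theorem sgn_symmDiff (x : ℕ) (s t : Finset ℕ) :
    sgn S x (symmDiff s t) = sgn S x s * sgn S x t := by
  have h1 : (symmDiff s t).filter (x < ·) = symmDiff (s.filter (x < ·)) (t.filter (x < ·)) := by
    ext y
    simp only [Finset.mem_filter, Finset.mem_symmDiff]
    tauto
  generalize hs : s.filter (x < ·) = s' at h1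
  generalize ht : t.filter (x < ·) = t' at h1
  rw [sgn, sgn, sgn, h1, hs, ht, ← pow_add, symmDiff_def, Finset.sup_eq_union,
    Finset.card_union_of_disjoint disjoint_sdiff_sdiff]
  have h2 := Finset.card_sdiff_add_card_inter s' t'
  have h3 := Finset.card_sdiff_add_card_inter t' s'
  rw [Finset.inter_comm] at h3
  rw [← h2, ← h3, show (s' \ t').card + (s' ∩ t').card + ((t' \ s').card + (s' ∩ t').card)
    = (s' \ t').card + (t' \ s').card + 2 * (s' ∩ t').card by ring, pow_add _ _ (2 * _), pow_mul]
  simp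

theorem contr_sortD (u : ℕ → S) (F : List ℕ → S) (s : Finset ℕ) :
    contr u F (sortD s) = ∑ x ∈ s, sgn S x s * u x * F (sortD (s.erase x)) := by
  induction s using Finset.induction_on_max generalizing F with
  | empty => simp [contr]
  | insert a s h ih =>
    have ha : a ∉ s := fun ha => lt_irrefl _ (h a ha)
    rw [sortD_insert_max h, contr_cons, ih, Finset.sum_insert ha, Finset.erase_insert ha,
      sub_eq_add_neg, ← Finset.sum_neg_distrib]
    congr 1
    · rw [sgn, Finset.filter_eq_empty_iff.mpr]
      · simp
      · intro x hx
        rcases Finset.mem_insert.mp hx with rfl | hx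
        · simp
        · simpa using (h x hx).le
    · refine Finset.sum_congr rfl fun x hx => ?_
      rw [Finset.erase_insert_of_ne (h x hx).ne',
        sortD_insert_max fun y hy => h y (Finset.mem_of_mem_erase hy), sgn, sgn,
        Finset.filter_insert, if_pos (h x hx), Finset.card_insert_of_notMem (by simp [ha])]
      ring

theorem move_front {F : List ℕ → S} {x : ℕ} (l₁ l₂ : List ℕ)
    (h : ∀ l₁ l₂ y, y ≠ x → F (l₁ ++ y :: x :: l₂) = -F (l₁ ++ x :: y :: l₂))
    (hl : ∀ y ∈ l₁, y ≠ x) : F (l₁ ++ x :: l₂) = (-1) ^ l₁.length * F (x :: (l₁ ++ l₂)) := by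
  induction l₁ using List.reverseRecOn generalizing l₂ with
  | nil => simp
  | append_singleton l₁ y ih =>
    rw [List.append_assoc, List.singleton_append, h _ _ _ (hl y (by simp)),
      ih _ fun z hz => hl z (by simp [hz])]
    simp [pow_succ]

/-- Antisymmetry is required only between `x` and a different entry: for `fock` it fails at a
repeated index 0. -/
theorem cons_sortD_of_notMem {F : List ℕ → S} {x : ℕ} {s : Finset ℕ}
    (h : ∀ l₁ l₂ y, y ≠ x → F (l₁ ++ y :: x :: l₂) = -F (l₁ ++ x :: y :: l₂)) (hx : x ∉ s) :
    F (x :: sortD s) = sgn S x s * F (sortD (insert x s)) := by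
  have h1 : (insert x s).filter (x < ·) = s.filter (x < ·) := by
    rw [Finset.filter_insert, if_neg (lt_irrefl x)]
  have h2 : sortD ((insert x s).filter (¬ x < ·)) = x :: sortD (s.filter (¬ x < ·)) := by
    rw [Finset.filter_insert, if_pos (lt_irrefl x), sortD_insert_max]
    intro y hy
    simp only [Finset.mem_filter, not_lt] at hy
    exact lt_of_le_of_ne hy.2 fun h => hx (h ▸ hy.1)
  rw [sortD_split (insert x s) x, h1, h2, move_front _ _ h, ← sortD_split, Finset.length_sort,
    ← sgn, ← mul_assoc, sgn_mul_self, one_mul]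
  intro y hy
  simp only [Finset.mem_sort, Finset.mem_filter] at hy
  exact hy.2.ne'

/-- Moving the second `x` forward until it is adjacent to the first changes the value only by a
sign. -/
theorem cons_sortD_of_mem {F : List ℕ → S} {x : ℕ} {s : Finset ℕ}
    (h : ∀ l₁ l₂ y, y ≠ x → F (l₁ ++ y :: x :: l₂) = -F (l₁ ++ x :: y :: l₂))
    (h0 : ∀ l, F (x :: x :: l) = 0) (hx : x ∈ s) : F (x :: sortD s) = 0 := by
  have h1 := cons_sortD_of_notMem (F := fun l => F (x :: l))
    (fun l₁ l₂ y hy => by simpa using h (x :: l₁) l₂ y hy) (Finset.notMem_erase x s)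
  rw [Finset.insert_erase hx, h0] at h1
  have h2 := congrArg (sgn S x (s.erase x) * ·) h1
  simpa only [← mul_assoc, sgn_mul_self, one_mul, mul_zero] using h2.symm

theorem symmDiff_singleton_of_mem {x : ℕ} {s : Finset ℕ} (h : x ∈ s) :
    symmDiff s {x} = s.erase x := by
  ext y
  simp only [Finset.mem_symmDiff, Finset.mem_singleton, Finset.mem_erase]
  by_cases hy : y = x <;> simp_all

theorem symmDiff_singleton_of_notMem {x : ℕ} {s : Finset ℕ} (h : x ∉ s) :
    symmDiff s {x} = insert x s := by
  ext y
  simp only [Finset.mem_symmDiff, Finset.mem_singleton, Finset.mem_insert]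
  by_cases hy : y = x <;> simp_all

end Sorted

/-! ### Plücker relations for Pfaffians -/

section Pfaffian

variable {S : Type*} [CommRing S] {a : ℕ → ℕ → S}

theorem pf_swap (ha : ∀ x y, a x y = -a y x) (x y : ℕ) (l₁ l₂ : List ℕ) :
    pf a (l₁ ++ x :: y :: l₂) = -pf a (l₁ ++ y :: x :: l₂) := by
  induction hn : l₁.length + l₂.length using Nat.strong_induction_on generalizing l₁ l₂ with
  | _ n ih =>
    rcases l₁ with _ | ⟨z, l₁⟩
    · simp only [List.nil_append, pf_cons, contr_cons]
      have h1 : contr (a x) (fun l => contr (a y) (pf a) l) l₂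
        = -contr (a y) (fun l => contr (a x) (pf a) l) l₂ := contr_contr _ _ _ _
      rw [h1, ha x y]
      ring
    · simp only [List.cons_append, pf_cons]
      refine contr_swap _ _ _ _ _ _ fun l₁' l₂' h => ih _ ?_ _ _ rfl
      simp only [List.length_cons] at hn
      omega

theorem pf_cons_cons_self (ha : ∀ x, a x x = 0) (x : ℕ) (l : List ℕ) :
    pf a (x :: x :: l) = 0 := by
  simp only [pf_cons, contr_cons]
  have h1 : contr (a x) (fun l => contr (a x) (pf a) l) l = 0 := contr_contr_self _ _ _
  rw [h1, ha]
  ring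

/-- Expanding the Pfaffians with a prepended index turns both sums into the same double sum over A ×
B, one with `a i j` and the other with `a j i`. -/
theorem pf_plucker_aux (ha : ∀ x y, a x y = -a y x) (A B : Finset ℕ) :
    ∑ i ∈ A, sgn S i A * pf a (sortD (A.erase i)) * pf a (i :: sortD B)
      + ∑ j ∈ B, sgn S j B * pf a (sortD (B.erase j)) * pf a (j :: sortD A) = 0 := by
  simp only [pf_cons, contr_sortD, Finset.mul_sum]
  rw [Finset.sum_comm, ← Finset.sum_add_distrib]
  refine Finset.sum_eq_zero fun j _ => ?_
  rw [← Finset.sum_add_distrib]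
  refine Finset.sum_eq_zero fun i _ => ?_
  rw [ha i j]
  ring

/-- Indices common to A and B drop out of `pf_plucker_aux`, since they repeat a row. Sorting the
prepended index into place supplies the missing part of the sign. -/
theorem pf_plucker (ha : ∀ x y, a x y = -a y x) (ha0 : ∀ x, a x x = 0) (A B : Finset ℕ) :
    ∑ i ∈ symmDiff A B, sgn S i (symmDiff A B) * pf a (sortD (symmDiff A {i}))
      * pf a (sortD (symmDiff B {i})) = 0 := by
  have key : ∀ A B : Finset ℕ,
      ∑ i ∈ A, sgn S i A * pf a (sortD (A.erase i)) * pf a (i :: sortD B) =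
      ∑ i ∈ A \ B, sgn S i (symmDiff A B) * pf a (sortD (symmDiff A {i}))
        * pf a (sortD (symmDiff B {i})) := by
    intro A B
    rw [← Finset.sum_subset (Finset.sdiff_subset (s := A) (t := B))]
    · refine Finset.sum_congr rfl fun i hi => ?_
      rw [Finset.mem_sdiff] at hi
      rw [cons_sortD_of_notMem (fun l₁ l₂ y _ => pf_swap ha y i l₁ l₂) hi.2, sgn_symmDiff,
        symmDiff_singleton_of_mem hi.1, symmDiff_singleton_of_notMem hi.2]
      ring
    · intro i hi hi'
      have : i ∈ B := by simpa [hi] using hi'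
      rw [cons_sortD_of_mem (fun l₁ l₂ y _ => pf_swap ha y i l₁ l₂)
        (fun l => pf_cons_cons_self ha0 i l) this, mul_zero]
  have h := pf_plucker_aux ha A B
  rw [key, key] at h
  rw [symmDiff_def, Finset.sup_eq_union, Finset.sum_union disjoint_sdiff_sdiff, ← Finset.sup_eq_union,
    ← symmDiff_def, ← h, symmDiff_comm B A]
  congr 1
  exact Finset.sum_congr rfl fun i _ => by ring

end Pfaffian

/-! ### Four-term relations and Plücker relations -/

section FourTerm

variable {R : Type*} [CommRing R]

theorem drop0_self (l : StrictPartition) : drop0 l.1 = l :=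
  Subtype.ext (Finset.erase_eq_of_notMem l.2)

theorem drop0_union (s t : Finset ℕ) : drop0 ((drop0 s).1 ∪ t) = drop0 (s ∪ t) := by
  apply Subtype.ext
  ext x
  simp only [drop0, Finset.mem_erase, Finset.mem_union]
  tauto

/-- The left-hand side of the Plücker relation for `A`, `B`. -/
def plucker (c : Finset ℕ → R) (A B : Finset ℕ) : R :=
  ∑ i ∈ symmDiff A B, sgn R i (symmDiff A B) * c (symmDiff A {i}) * c (symmDiff B {i})

theorem plucker_four (c : Finset ℕ → R) {i j k l : ℕ} {T : Finset ℕ} (hij : j < i) (hjk : k < j)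
    (hkl : l < k) (hi : i ∉ T) (hj : j ∉ T) (hk : k ∉ T) (hl : l ∉ T) :
    plucker c (insert i T) (T ∪ {j, k, l}) = c T * c (T ∪ {i, j, k, l})
      - c (T ∪ {i, j}) * c (T ∪ {k, l}) + c (T ∪ {i, k}) * c (T ∪ {j, l})
      - c (T ∪ {i, l}) * c (T ∪ {j, k}) := by
  have hD : symmDiff (insert i T) (T ∪ {j, k, l}) = {i, j, k, l} := by
    ext x
    simp only [Finset.mem_symmDiff, Finset.mem_insert, Finset.mem_union, Finset.mem_singleton]
    by_cases x = i <;> by_cases x = j <;> by_cases x = k <;> by_cases x = l <;> grind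
  have e (s t : Finset ℕ) (h : ∀ x, x ∈ s ↔ x ∈ t) : s = t := Finset.ext h
  have si : sgn R i {i, j, k, l} = 1 := by
    rw [sgn, Finset.filter_eq_empty_iff.mpr]
    · simp
    · intro x hx; simp at hx; omega
  have sj : sgn R j {i, j, k, l} = -1 := by
    rw [sgn, show Finset.filter (j < ·) {i, j, k, l} = {i} from e _ _ fun x => by
      simp only [Finset.mem_filter, Finset.mem_insert, Finset.mem_singleton]; omega]
    simp
  have sk : sgn R k {i, j, k, l} = 1 := by
    rw [sgn, show Finset.filter (k < ·) {i, j, k, l} = {i, j} from e _ _ fun x => by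
      simp only [Finset.mem_filter, Finset.mem_insert, Finset.mem_singleton]; omega,
      Finset.card_pair (by omega)]
    simp
  have sl : sgn R l {i, j, k, l} = -1 := by
    rw [sgn, show Finset.filter (l < ·) {i, j, k, l} = {i, j, k} from e _ _ fun x => by
      simp only [Finset.mem_filter, Finset.mem_insert, Finset.mem_singleton]; omega,
      Finset.card_eq_three.mpr ⟨i, j, k, by omega, by omega, by omega, rfl⟩]
    ring
  rw [plucker, hD, Finset.sum_insert (by simp; omega), Finset.sum_insert (by simp; omega),
    Finset.sum_insert (by simp; omega), Finset.sum_singleton, si, sj, sk, sl]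
  rw [show symmDiff (insert i T) {i} = T from e _ _ fun x => by
      simp only [Finset.mem_symmDiff, Finset.mem_insert, Finset.mem_singleton]; grind,
    show symmDiff (T ∪ {j, k, l}) {i} = T ∪ {i, j, k, l} from e _ _ fun x => by
      simp only [Finset.mem_symmDiff, Finset.mem_insert, Finset.mem_union,
        Finset.mem_singleton]; grind,
    show symmDiff (insert i T) {j} = T ∪ {i, j} from e _ _ fun x => by
      simp only [Finset.mem_symmDiff, Finset.mem_insert, Finset.mem_union,
        Finset.mem_singleton]; grind,
    show symmDiff (T ∪ {j, k, l}) {j} = T ∪ {k, l} from e _ _ fun x => by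
      simp only [Finset.mem_symmDiff, Finset.mem_insert, Finset.mem_union,
        Finset.mem_singleton]; grind,
    show symmDiff (insert i T) {k} = T ∪ {i, k} from e _ _ fun x => by
      simp only [Finset.mem_symmDiff, Finset.mem_insert, Finset.mem_union,
        Finset.mem_singleton]; grind,
    show symmDiff (T ∪ {j, k, l}) {k} = T ∪ {j, l} from e _ _ fun x => by
      simp only [Finset.mem_symmDiff, Finset.mem_insert, Finset.mem_union,
        Finset.mem_singleton]; grind,
    show symmDiff (insert i T) {l} = T ∪ {i, l} from e _ _ fun x => by
      simp only [Finset.mem_symmDiff, Finset.mem_insert, Finset.mem_union,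
        Finset.mem_singleton]; grind,
    show symmDiff (T ∪ {j, k, l}) {l} = T ∪ {j, k} from e _ _ fun x => by
      simp only [Finset.mem_symmDiff, Finset.mem_insert, Finset.mem_union,
        Finset.mem_singleton]; grind]
  ring

/-- A family of ring elements, indexed by the sets of even cardinality, that satisfies the
four-term relations and contains no zero divisor, is up to normalization a family of Pfaffians. -/
theorem exists_pf_of_four (c : Finset ℕ → R) (hc : ∀ s, c s ∈ nonZeroDivisors R)
    (h4 : ∀ (T : Finset ℕ) (i j k l : ℕ), Even T.card → j < i → k < j → l < k →
      i ∉ T → j ∉ T → k ∉ T → l ∉ T → plucker c (insert i T) (T ∪ {j, k, l}) = 0) :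
    ∃ a : ℕ → ℕ → R, (∀ x y, a x y = -a y x) ∧ (∀ x, a x x = 0) ∧
      ∀ m s, s.card = 2 * m → c ∅ ^ m * c s = c ∅ * pf a (sortD s) := by
  -- The candidate matrix consists of the two-element coefficients, made skew-symmetric.
  let a : ℕ → ℕ → R := fun x y => if y < x then c {x, y} else if x < y then -c {x, y} else 0
  have ha : ∀ x y, a x y = -a y x := fun x y => by
    rcases lt_trichotomy x y with h | rfl | h
    · simp [a, h, h.not_gt, Finset.pair_comm]
    · simp [a]
    · simp [a, h, h.not_gt, Finset.pair_comm]
  have ha0 : ∀ x, a x x = 0 := fun x => by simp [a]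
  refine ⟨a, ha, ha0, fun m => ?_⟩
  induction m using Nat.strong_induction_on with
  | _ m ih =>
    intro s hs
    rcases m with _ | _ | m
    -- The extra factor `c ∅` in the claim replaces the natural exponent m − 1, which would be
    -- negative here.
    · obtain rfl : s = ∅ := Finset.card_eq_zero.mp (by simpa using hs)
      simp [pf_nil]
    · obtain ⟨x, y, hxy, rfl⟩ := Finset.card_eq_two.mp (by simpa using hs)
      wlog h : y < x generalizing x y
      · rw [Finset.pair_comm]
        exact this y x hxy.symm (by rwa [Finset.pair_comm]) (by omega)
      have h1 : sortD {x, y} = [x, y] := by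
        rw [sortD_insert_max (by simpa using h), sortD, Finset.sort_singleton]
      rw [h1, pf_cons, contr_cons, pf_nil, contr_nil]
      simp [a, h]
    -- The four largest elements i > j > k > l are split off; the rest T has 2m elements, so every
    -- set in the four-term relation other than `s` is covered by induction.
    · have hmax : ∀ t : Finset ℕ, 0 < t.card → ∃ i ∈ t, (∀ y ∈ t.erase i, y < i) ∧
          (t.erase i).card = t.card - 1 := fun t ht => by
        have h0 := Finset.card_pos.mp ht
        refine ⟨t.max' h0, t.max'_mem h0, fun y hy => ?_, Finset.card_erase_of_mem (t.max'_mem h0)⟩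
        exact t.lt_max'_of_mem_erase_max' h0 hy
      obtain ⟨i, hi, hi', hi''⟩ := hmax s (by omega)
      obtain ⟨j, hj, hj', hj''⟩ := hmax (s.erase i) (by omega)
      obtain ⟨k, hk, hk', hk''⟩ := hmax ((s.erase i).erase j) (by omega)
      obtain ⟨l, hl, hl', hl''⟩ := hmax (((s.erase i).erase j).erase k) (by omega)
      have hij := hi' j hj
      have hjk := hj' k hk
      have hkl := hk' l hl
      generalize hT : (((s.erase i).erase j).erase k).erase l = T at hl'' hl'
      have hsT : T ∪ {i, j, k, l} = s := by
        subst hT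
        ext x
        simp only [Finset.mem_union, Finset.mem_erase, Finset.mem_insert, Finset.mem_singleton] at *
        grind
      have hiT : i ∉ T := by subst hT; simp
      have hjT : j ∉ T := by subst hT; simp
      have hkT : k ∉ T := by subst hT; simp
      have hlT : l ∉ T := by subst hT; simp
      have hcard : T.card = 2 * m := by omega
      have hpair : ∀ x y, x ≠ y → x ∉ T → y ∉ T → (T ∪ {x, y}).card = 2 * (m + 1) :=
        fun x y hxy hx hy => by
          rw [Finset.card_union_of_disjoint, hcard, Finset.card_pair hxy]
          · ring
          · simp [Finset.disjoint_insert_right, hx, hy]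
      have e1 := h4 T i j k l ⟨m, by omega⟩ hij hjk hkl hiT hjT hkT hlT
      have e2 := pf_plucker ha ha0 (insert i T) (T ∪ {j, k, l})
      change plucker (fun s => pf a (sortD s)) _ _ = 0 at e2
      rw [plucker_four _ hij hjk hkl hiT hjT hkT hlT] at e1 e2
      have i0 := ih m (by omega) T hcard
      have i1 := ih (m + 1) (by omega) _ (hpair i j (by omega) hiT hjT)
      have i2 := ih (m + 1) (by omega) _ (hpair k l (by omega) hkT hlT)
      have i3 := ih (m + 1) (by omega) _ (hpair i k (by omega) hiT hkT)
      have i4 := ih (m + 1) (by omega) _ (hpair j l (by omega) hjT hlT)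
      have i5 := ih (m + 1) (by omega) _ (hpair i l (by omega) hiT hlT)
      have i6 := ih (m + 1) (by omega) _ (hpair j k (by omega) hjT hkT)
      rw [hsT] at e1 e2
      -- The relations `e1` for `c` and `e2` for the Pfaffians contain the top term only multiplied
      -- by the term of T. Cancelling that factor is where non-zero-divisors are needed.
      rw [← mul_cancel_left_mem_nonZeroDivisors
        (mul_mem (pow_mem (hc ∅) m) (hc T) : c ∅ ^ m * c T ∈ nonZeroDivisors R)]
      linear_combination (c ∅ ^ (m + 1) * c ∅ ^ (m + 1)) * e1 - c ∅ * c ∅ * e2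
        - c ∅ * pf a (sortD s) * i0
        + c ∅ ^ (m + 1) * c (T ∪ {k, l}) * i1 + c ∅ * pf a (sortD (T ∪ {i, j})) * i2
        - c ∅ ^ (m + 1) * c (T ∪ {j, l}) * i3 - c ∅ * pf a (sortD (T ∪ {i, k})) * i4
        + c ∅ ^ (m + 1) * c (T ∪ {j, k}) * i5 + c ∅ * pf a (sortD (T ∪ {i, l})) * i6

theorem card_symmDiff_singleton (s : Finset ℕ) (i : ℕ) :
    (i ∈ s ∧ (symmDiff s {i}).card + 1 = s.card) ∨
      (i ∉ s ∧ (symmDiff s {i}).card = s.card + 1) := by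
  by_cases h : i ∈ s
  · exact .inl ⟨h, by rw [symmDiff_singleton_of_mem h, Finset.card_erase_add_one h]⟩
  · exact .inr ⟨h, by rw [symmDiff_singleton_of_notMem h, Finset.card_insert_of_notMem h]⟩

theorem plucker_of_four (c : Finset ℕ → R) (hc : ∀ s, c s ∈ nonZeroDivisors R)
    (h4 : ∀ (T : Finset ℕ) (i j k l : ℕ), Even T.card → j < i → k < j → l < k →
      i ∉ T → j ∉ T → k ∉ T → l ∉ T → plucker c (insert i T) (T ∪ {j, k, l}) = 0)
    {A B : Finset ℕ} (hA : Odd A.card) (hB : Odd B.card) : plucker c A B = 0 := by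
  obtain ⟨a, ha, ha0, h⟩ := exists_pf_of_four c hc h4
  have h1 : c ∅ ^ ((A.card + B.card) / 2) * plucker c A B = c ∅ ^ 2 *
      plucker (fun s => pf a (sortD s)) A B := by
    rw [plucker, plucker, Finset.mul_sum, Finset.mul_sum]
    refine Finset.sum_congr rfl fun i hi => ?_
    obtain ⟨m, hm⟩ : Even (symmDiff A {i}).card := by
      rcases card_symmDiff_singleton A i with h | h <;> grind
    obtain ⟨n, hn⟩ : Even (symmDiff B {i}).card := by
      rcases card_symmDiff_singleton B i with h | h <;> grind
    -- One of A, B loses i and the other gains it, so the total exponent is the same in every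
    -- summand.
    have hmn : (A.card + B.card) / 2 = m + n := by
      rw [Finset.mem_symmDiff] at hi
      rcases card_symmDiff_singleton A i with h | h <;>
        rcases card_symmDiff_singleton B i with h' | h' <;> grind
    have e1 := h m (symmDiff A {i}) (by omega)
    have e2 := h n (symmDiff B {i}) (by omega)
    rw [hmn]
    linear_combination (sgn R i (symmDiff A B)) *
      (c ∅ ^ n * c (symmDiff B {i}) * e1 + c ∅ * pf a (sortD (symmDiff A {i})) * e2)
  have h2 : plucker (fun s => pf a (sortD s)) A B = 0 := pf_plucker ha ha0 A B
  rw [h2, mul_zero] at h1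
  exact (mul_left_mem_nonZeroDivisors_eq_zero_iff (pow_mem (hc ∅) _)).mp h1

theorem pluckerRelations_iff {C : StrictPartition → R} : PluckerRelations C ↔
    ∀ A B : Finset ℕ, Odd A.card → Odd B.card → plucker (fun s => C (drop0 s)) A B = 0 := Iff.rfl

theorem drop0_symmDiff_zero (s : Finset ℕ) : drop0 (symmDiff s {0}) = drop0 s := by
  apply Subtype.ext
  ext x
  simp only [drop0, Finset.mem_erase, Finset.mem_symmDiff, Finset.mem_singleton]
  tauto

/-- Toggling 0 in both sets changes neither their symmetric difference nor any subscript once zeros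
are dropped. -/
theorem plucker_toggle_zero (C : StrictPartition → R) (A B : Finset ℕ) :
    plucker (fun s => C (drop0 s)) (symmDiff A {0}) (symmDiff B {0})
      = plucker (fun s => C (drop0 s)) A B := by
  have h1 : symmDiff (symmDiff A {0}) (symmDiff B {0}) = symmDiff A B := by
    rw [symmDiff_symmDiff_symmDiff_comm, symmDiff_self, symmDiff_bot]
  have h2 : ∀ (s : Finset ℕ) (i : ℕ), drop0 (symmDiff (symmDiff s {0}) {i})
      = drop0 (symmDiff s {i}) := fun s i => by
    rw [symmDiff_right_comm, drop0_symmDiff_zero]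
  simp only [plucker, h1, h2]

/-- Two sets of even size become odd on toggling 0. This covers the four-term relations whose α has
an odd number of parts. -/
theorem plucker_eq_zero_of_even_add {C : StrictPartition → R} (h : PluckerRelations C)
    {A B : Finset ℕ} (hAB : Even (A.card + B.card)) :
    plucker (fun s => C (drop0 s)) A B = 0 := by
  rw [pluckerRelations_iff] at h
  rcases Nat.even_or_odd A.card with hA | hA
  · rw [← plucker_toggle_zero]
    apply h
    · rcases card_symmDiff_singleton A 0 with h | h <;> grind
    · rcases card_symmDiff_singleton B 0 with h | h <;> grind
  · exact h A B hA (by grind)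

theorem fourTerm_of_plucker {C : StrictPartition → R} (h : PluckerRelations C) :
    FourTermRelations C := by
  intro α b₁ b₂ b₃ b₄ h34 h23 h12 h1 h2 h3 h4
  have h5 := plucker_eq_zero_of_even_add h (A := insert b₁ α.1) (B := α.1 ∪ {b₂, b₃, b₄}) (by
    rw [Finset.card_insert_of_notMem h1, Finset.card_union_of_disjoint
      (by simp [Finset.disjoint_insert_right, h2, h3, h4]),
      Finset.card_eq_three.mpr ⟨b₂, b₃, b₄, by omega, by omega, by omega, rfl⟩]
    exact ⟨α.1.card + 2, by ring⟩)
  rw [plucker_four _ h12 h23 h34 h1 h2 h3 h4] at h5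
  simpa only [drop0_self] using h5

theorem plucker_of_fourTerm {C : StrictPartition → R} (hC : ∀ l, C l ∈ nonZeroDivisors R)
    (h : FourTermRelations C) : PluckerRelations C := by
  rw [pluckerRelations_iff]
  intro A B hA hB
  refine plucker_of_four _ (fun s => hC _) ?_ hA hB
  intro T i j k l hT hij hjk hkl hi hj hk hl
  rw [plucker_four _ hij hjk hkl hi hj hk hl]
  -- T may contain 0, which α may not; replacing T by `drop0 T` leaves all subscripts unchanged.
  have hmem : ∀ b, b ∉ T → b ∉ (drop0 T).1 := fun b hb hbT => hb (Finset.mem_of_mem_erase hbT)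
  simpa only [drop0_union] using
    h (drop0 T) i j k l hkl hjk hij (hmem i hi) (hmem j hj) (hmem k hk) (hmem l hl)

end FourTerm

/-! ### The polynomials `h_n` -/

section Exponential

open PowerSeries

/-- The equation F' = L F determines each coefficient from the earlier ones, because n + 1 is
invertible in a ℂ-algebra. It replaces manipulations of exponentials below. -/
theorem eq_of_derivative_eq_mul {A : Type*} [CommRing A] [Algebra ℂ A] {F G L : PowerSeries A}
    (hF : derivative A F = L * F) (hG : derivative A G = L * G)
    (h0 : coeff 0 F = coeff 0 G) : F = G := by
  ext n
  induction n using Nat.strong_induction_on with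
  | _ n ih =>
    rcases n with _ | n
    · exact h0
    · have h1 := congrArg (coeff n) hF
      have h2 := congrArg (coeff n) hG
      rw [coeff_derivative, coeff_mul] at h1 h2
      have h3 : coeff (n + 1) F * ((n : A) + 1) = coeff (n + 1) G * ((n : A) + 1) := by
        rw [h1, h2]
        refine Finset.sum_congr rfl fun p hp => ?_
        rw [ih p.2 (by have := Finset.HasAntidiagonal.mem_antidiagonal.mp hp; omega)]
      have h4 : IsUnit ((n : A) + 1) := by
        have h5 : IsUnit ((n : ℂ) + 1) := (Nat.cast_add_one_ne_zero n).isUnit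
        simpa using h5.map (algebraMap ℂ A)
      exact h4.mul_right_cancel h3

/-- The derivative of `∑ x_i z^{2i+1}` with respect to `z`. -/
def dxi {A : Type*} [CommRing A] (x : ℕ → A) : PowerSeries A :=
  mk fun n => if Even n then ((n : A) + 1) * x (n / 2) else 0

theorem derivative_expSeries (c : ℂ) : derivative _ (expSeries (c • xi)) =
    dxi (fun i => (c • MvPolynomial.X i : MvPolynomial ℕ ℂ)) * expSeries (c • xi) := by
  rw [expSeries, derivative_subst (hasSubst_xi c), derivative_exp, mul_comm]
  congr 1
  ext1 n
  rw [coeff_derivative, coeff_smul, xi, coeff_mk, dxi, coeff_mk]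
  by_cases hn : Even n
  · obtain ⟨k, rfl⟩ := hn
    have h1 : (k + k + 1) / 2 = k := by omega
    have h2 : (k + k) / 2 = k := by omega
    have h3 : Odd (k + k + 1) := ⟨k, by ring⟩
    simp only [h1, h2, h3, if_true, Even.add_self]
    ring
  · have h3 : ¬ Odd (n + 1) := by rw [Nat.not_odd_iff_even]; exact (Nat.not_even_iff_odd.mp hn).add_one
    simp [hn, h3]

theorem coeff_zero_expSeries (c : ℂ) : coeff 0 (expSeries (c • xi)) = 1 := by
  rw [expSeries, coeff_subst' (hasSubst_xi c), finsum_eq_single _ 0]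
  · simp
  · intro n hn
    have h3 : constantCoeff (c • xi) = 0 := by
      simp [xi, ← coeff_zero_eq_constantCoeff_apply]
    rw [coeff_zero_eq_constantCoeff_apply, map_pow, h3, zero_pow hn, smul_zero]

theorem map_dxi {A B : Type*} [CommRing A] [CommRing B] (φ : A →+* B) (x : ℕ → A) :
    PowerSeries.map φ (dxi x) = dxi fun i => φ (x i) := by
  ext n
  simp only [dxi, coeff_map, coeff_mk]
  split_ifs <;> simp

theorem derivative_map {A B : Type*} [CommRing A] [CommRing B] (φ : A →+* B) (F : PowerSeries A) :
    derivative B (PowerSeries.map φ F) = PowerSeries.map φ (derivative A F) := by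
  ext n
  simp [coeff_derivative]

variable {A : Type*} [CommRing A] [Algebra ℂ A]

/-- `∑ h_n(x) zⁿ`. -/
def hSeries (x : ℕ → A) : PowerSeries A := mk fun n => MvPolynomial.aeval x (h n)

theorem coeff_hSeries (x : ℕ → A) (n : ℕ) :
    coeff n (hSeries x) = MvPolynomial.aeval x (h n) := coeff_mk _ _

theorem map_aeval_expSeries (x : ℕ → A) (c : ℂ) :
    derivative A (PowerSeries.map (MvPolynomial.aeval x : _ →ₐ[ℂ] A).toRingHom
      (expSeries (c • xi))) = dxi (fun i => c • x i) *
      PowerSeries.map (MvPolynomial.aeval x : _ →ₐ[ℂ] A).toRingHom (expSeries (c • xi)) := by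
  rw [derivative_map, derivative_expSeries, map_mul, map_dxi]
  simp

theorem hSeries_eq (x : ℕ → A) : hSeries x =
    PowerSeries.map (MvPolynomial.aeval x : _ →ₐ[ℂ] A).toRingHom (expSeries ((1 : ℂ) • xi)) := by
  ext n
  rw [one_smul, coeff_hSeries, coeff_map]
  rfl

theorem derivative_hSeries (x : ℕ → A) : derivative A (hSeries x) = dxi x * hSeries x := by
  rw [hSeries_eq, map_aeval_expSeries]
  simp

theorem coeff_zero_hSeries (x : ℕ → A) : coeff 0 (hSeries x) = 1 := by
  rw [hSeries_eq, coeff_map, coeff_zero_expSeries, map_one]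

theorem eq_hSeries {x : ℕ → A} {F : PowerSeries A} (hF : derivative A F = dxi x * F)
    (h0 : coeff 0 F = 1) : F = hSeries x :=
  eq_of_derivative_eq_mul hF (derivative_hSeries x) (h0.trans (coeff_zero_hSeries x).symm)

theorem aeval_q (x : ℕ → A) (n : ℕ) :
    MvPolynomial.aeval x (q n) = MvPolynomial.aeval (fun i => (2 : ℂ) • x i) (h n) := by
  rw [← coeff_hSeries, ← eq_hSeries (map_aeval_expSeries x 2)]
  · rw [coeff_map]; rfl
  · rw [coeff_map, coeff_zero_expSeries, map_one]

/-- Since ξ(y, z) is odd in z, replacing z by −z inverts its exponential. -/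
theorem hSeries_sub (x y : ℕ → A) :
    hSeries x * rescale (-1) (hSeries y) = hSeries fun i => x i - y i := by
  apply eq_hSeries
  · have h1 : derivative A (rescale (-1) (hSeries y)) = -rescale (-1) (derivative A (hSeries y)) := by
      ext n
      simp only [coeff_derivative, coeff_rescale, map_neg]
      ring
    have h2 : rescale (-1) (dxi y) = dxi y := by
      ext n
      rw [coeff_rescale, dxi, coeff_mk]
      split_ifs with hn
      · rw [hn.neg_one_pow, one_mul]
      · simp
    have h3 : dxi (fun i => x i - y i) = dxi x - dxi y := by
      ext n
      simp only [dxi, coeff_mk, map_sub]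
      split_ifs <;> ring
    rw [Derivation.leibniz, h1, derivative_hSeries, derivative_hSeries, map_mul, h2, h3,
      smul_eq_mul, smul_eq_mul]
    ring
  · rw [coeff_mul]
    simp [-coeff_zero_eq_constantCoeff, coeff_rescale, coeff_zero_hSeries]

theorem aeval_sub_h (x y : ℕ → A) (n : ℕ) :
    MvPolynomial.aeval (fun i => x i - y i) (h n) = ∑ p ∈ Finset.HasAntidiagonal.antidiagonal n,
      MvPolynomial.aeval x (h p.1) * ((-1) ^ p.2 * MvPolynomial.aeval y (h p.2)) := by
  rw [← coeff_hSeries, ← hSeries_sub, coeff_mul]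
  simp [coeff_rescale, coeff_hSeries]

/-- The series Σ 2(kz)^{2i+1}/(2i+1) is log((1+kz)/(1−kz)), so the shift multiplies the exponential
by (1−kz)/(1+kz). Here k plays the part of the inverse spectral parameter. -/
theorem hSeries_shift (x : ℕ → A) (k : A) :
    (1 + C k * X) * hSeries (fun i => x i - algebraMap ℂ A (2 / (2 * i + 1)) * k ^ (2 * i + 1))
      = (1 - C k * X) * hSeries x := by
  have hg (k : A) : (1 - C k * X) * mk (fun n => k ^ n) = 1 := by
    ext n
    rw [sub_mul, one_mul, mul_assoc, map_sub, coeff_C_mul, coeff_mk, coeff_one]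
    rcases n with _ | n
    · simp
    · rw [coeff_succ_X_mul, coeff_mk]
      simp [pow_succ']
  set g : PowerSeries A := mk fun n => k ^ n
  set g' : PowerSeries A := mk fun n => (-k) ^ n
  have h1 : (1 - C k * X) * g = 1 := hg k
  have h2 : (1 + C k * X) * g' = 1 := by simpa using hg (-k)
  have h3 : derivative A g = C k * g * g := by
    have h4 := congrArg (derivative A) h1
    rw [Derivation.leibniz, map_sub, Derivation.leibniz, derivative_C, derivative_X] at h4
    simp only [smul_eq_mul, mul_zero, add_zero, mul_one, Derivation.map_one_eq_zero, zero_sub] at h4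
    linear_combination g * h4 - derivative A g * h1
  set x' : ℕ → A := fun i => x i - algebraMap ℂ A (2 / (2 * i + 1)) * k ^ (2 * i + 1)
  -- Differentiating the shift gives 2k Σ (kz)ⁿ over even n, which is k(g + g') because the odd
  -- powers cancel.
  have h5 : dxi x = dxi x' + C k * (g + g') := by
    ext n
    simp only [dxi, map_add, coeff_mk, coeff_C_mul, g, g', x']
    split_ifs with hn
    · rw [hn.neg_pow]
      obtain ⟨m, rfl⟩ := hn
      have h6 : algebraMap ℂ A (2 / (2 * ((m + m) / 2 : ℕ) + 1)) * (((m + m : ℕ) : A) + 1) = 2 := by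
        have : ((m + m : ℕ) : A) + 1 = algebraMap ℂ A (2 * m + 1) := by
          rw [map_add, map_mul, map_natCast, map_ofNat, map_one]; push_cast; ring
        rw [this, ← map_mul, show (m + m) / 2 = m by omega, div_mul_cancel₀, map_ofNat]
        exact_mod_cast (2 * m).succ_ne_zero
      rw [show 2 * ((m + m) / 2) + 1 = m + m + 1 by omega, pow_succ]
      linear_combination k ^ (m + m) * k * h6
    · rw [(Nat.not_even_iff_odd.mp hn).neg_pow]; ring
  have h6 : (1 + C k * X) * hSeries x' * g = hSeries x := by
    apply eq_hSeries
    · rw [Derivation.leibniz, Derivation.leibniz, map_add, Derivation.leibniz, derivative_C,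
        derivative_X, h3, derivative_hSeries, h5]
      simp only [smul_eq_mul, mul_zero, add_zero, mul_one, Derivation.map_one_eq_zero, zero_add]
      linear_combination -(C k * hSeries x' * g) * h2
    · have h7 := coeff_zero_hSeries x'
      rw [coeff_zero_eq_constantCoeff_apply] at h7 ⊢
      rw [map_mul, map_mul, h7]
      simp [g, ← coeff_zero_eq_constantCoeff_apply, -coeff_zero_eq_constantCoeff]
  rw [← h6]
  linear_combination -((1 + C k * X) * hSeries x') * h1

theorem aeval_shift_h_succ (x : ℕ → A) (k : A) (n : ℕ) :
    MvPolynomial.aeval (fun i => x i - algebraMap ℂ A (2 / (2 * i + 1)) * k ^ (2 * i + 1))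
        (h (n + 1))
      + k * MvPolynomial.aeval
        (fun i => x i - algebraMap ℂ A (2 / (2 * i + 1)) * k ^ (2 * i + 1)) (h n)
      = MvPolynomial.aeval x (h (n + 1)) - k * MvPolynomial.aeval x (h n) := by
  have h1 := congrArg (coeff (n + 1)) (hSeries_shift x k)
  rw [add_mul, sub_mul, one_mul, one_mul, mul_assoc, mul_assoc, map_add, map_sub, coeff_C_mul,
    coeff_C_mul, coeff_succ_X_mul, coeff_succ_X_mul] at h1
  simpa only [coeff_hSeries] using h1

theorem aeval_h_zero (x : ℕ → A) : MvPolynomial.aeval x (h 0) = 1 := by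
  rw [← coeff_hSeries, coeff_zero_hSeries]

end Exponential

/-! ### Neutral fermions -/

section Fermions

variable (R : Type*) [CommRing R] [Algebra ℂ R]

/-- The polynomial `h_n`, extended by zero to negative indices. -/
def hZ (n : ℤ) : MvPolynomial ℕ R :=
  if 0 ≤ n then MvPolynomial.aeval MvPolynomial.X (h n.toNat) else 0

variable {R} in
/-- `f(t) ↦ f(t - 2[k⁻¹])`, as a polynomial in `k⁻¹`. -/
def shiftHom : MvPolynomial ℕ R →ₐ[R] Polynomial (MvPolynomial ℕ R) :=
  MvPolynomial.aeval fun i => Polynomial.C (MvPolynomial.X i)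
    - algebraMap ℂ _ (2 / (2 * i + 1)) * Polynomial.X ^ (2 * i + 1)

theorem hZ_natCast (n : ℕ) : hZ R n = MvPolynomial.aeval MvPolynomial.X (h n) := by
  simp [hZ]

theorem hZ_of_neg {n : ℤ} (hn : n < 0) : hZ R n = 0 := if_neg hn.not_ge

theorem hZ_zero : hZ R 0 = 1 := by simpa [aeval_h_zero] using hZ_natCast R 0

theorem shiftHom_hZ_succ (n : ℤ) : shiftHom (hZ R (n + 1)) + Polynomial.X * shiftHom (hZ R n)
    = Polynomial.C (hZ R (n + 1)) - Polynomial.X * Polynomial.C (hZ R n) := by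
  have h1 (x : ℕ) : shiftHom (hZ R x) = MvPolynomial.aeval (fun i =>
      (Polynomial.C (MvPolynomial.X i) : Polynomial (MvPolynomial ℕ R))
        - algebraMap ℂ _ (2 / (2 * i + 1)) * Polynomial.X ^ (2 * i + 1)) (h x) := by
    rw [hZ_natCast, ← AlgHom.restrictScalars_apply ℂ, ← AlgHom.comp_apply]
    congr 1
    ext i
    simp [shiftHom]
  have h2 (x : ℕ) : Polynomial.C (hZ R x) = MvPolynomial.aeval (fun i =>
      (Polynomial.C (MvPolynomial.X i) : Polynomial (MvPolynomial ℕ R))) (h x) := by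
    rw [hZ_natCast]
    change (IsScalarTower.toAlgHom ℂ (MvPolynomial ℕ R) (Polynomial (MvPolynomial ℕ R))) _ = _
    rw [← AlgHom.comp_apply]
    congr 1
    ext i
    simp
  rcases lt_trichotomy n (-1) with hn | rfl | hn
  · rw [hZ_of_neg R (n := n + 1) (by omega), hZ_of_neg R (n := n) (by omega)]
    simp
  · rw [hZ_of_neg R (n := -1) (by omega)]
    simp [hZ_zero]
  · lift n to ℕ using by omega
    have h3 := aeval_shift_h_succ (fun i : ℕ =>
      (Polynomial.C (MvPolynomial.X i) : Polynomial (MvPolynomial ℕ R))) Polynomial.X n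
    rw [← h1, ← h1, ← h2, ← h2] at h3
    exact_mod_cast h3

/-- The linear map `k⁻ᵐ ↦ h_{n+m}`. -/
def pairing (n : ℤ) : Polynomial (MvPolynomial ℕ R) →ₗ[MvPolynomial ℕ R] MvPolynomial ℕ R :=
  Polynomial.lsum fun m => LinearMap.toSpanSingleton _ _ (hZ R (n + m))

theorem pairing_monomial (n : ℤ) (m : ℕ) (c : MvPolynomial ℕ R) :
    pairing R n (Polynomial.monomial m c) = c * hZ R (n + m) := by
  rw [pairing, Polynomial.lsum_apply, Polynomial.sum_monomial_index] <;> simp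

theorem pairing_eq_sum (n : ℤ) (p : Polynomial (MvPolynomial ℕ R)) {N : ℕ}
    (hN : p.natDegree < N) :
    pairing R n p = ∑ m ∈ Finset.range N, p.coeff m * hZ R (n + m) := by
  rw [pairing, Polynomial.lsum_apply, Polynomial.sum_over_range' _ _ _ hN]
  · rfl
  · simp

theorem pairing_C_mul (n : ℤ) (c : MvPolynomial ℕ R) (p : Polynomial (MvPolynomial ℕ R)) :
    pairing R n (Polynomial.C c * p) = c * pairing R n p := by
  rw [← Polynomial.smul_eq_C_mul, map_smul, smul_eq_mul]

theorem pairing_mul_C (n : ℤ) (c : MvPolynomial ℕ R) (p : Polynomial (MvPolynomial ℕ R)) :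
    pairing R n (p * Polynomial.C c) = pairing R n p * c := by
  rw [mul_comm, pairing_C_mul, mul_comm]

theorem pairing_C (n : ℤ) (c : MvPolynomial ℕ R) :
    pairing R n (Polynomial.C c) = c * hZ R n := by
  simpa using pairing_monomial R n 0 c

theorem pairing_X_mul (n : ℤ) (p : Polynomial (MvPolynomial ℕ R)) :
    pairing R n (Polynomial.X * p) = pairing R (n + 1) p := by
  induction p using Polynomial.induction_on' with
  | add p q hp hq => rw [mul_add, map_add, map_add, hp, hq]
  | monomial m c =>
    rw [Polynomial.X_mul_monomial, pairing_monomial, pairing_monomial]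
    push_cast
    rw [add_assoc, add_comm (1 : ℤ)]

/-- The coefficient of `kⁿ` in the vertex operator `f ↦ e^{ξ(t,k)} f(t - 2[k⁻¹])`. -/
def vop (n : ℤ) : MvPolynomial ℕ R →ₗ[R] MvPolynomial ℕ R :=
  (pairing R n).restrictScalars R ∘ₗ shiftHom.toLinearMap

theorem vop_apply (n : ℤ) (f : MvPolynomial ℕ R) : vop R n f = pairing R n (shiftHom f) := rfl

/-- The two-point function. -/
def amp (n : ℤ) (m : ℕ) : MvPolynomial ℕ R := vop R n (hZ R m)

theorem amp_zero (n : ℤ) : amp R n 0 = hZ R n := by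
  rw [amp, Nat.cast_zero, hZ_zero, vop_apply, map_one, ← map_one Polynomial.C, pairing_C, one_mul]

/-- Under `pairing`, a factor k⁻¹ raises n by one; applied to `shiftHom_hZ_succ` this gives the same
recursion as `P_add`. -/
theorem amp_succ (n : ℤ) (m : ℕ) : amp R n (m + 1) + amp R (n + 1) m
    = hZ R n * hZ R (m + 1) - hZ R (n + 1) * hZ R m := by
  have h1 := congrArg (pairing R n) (shiftHom_hZ_succ R m)
  rw [map_add, map_sub, pairing_X_mul, pairing_X_mul, pairing_C, pairing_C] at h1
  simp only [amp, vop_apply, Nat.cast_add, Nat.cast_one, h1]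
  ring

/-- Both sides obey the same recursion in m, by `amp_succ` and `shiftHom_hZ_succ`, and they agree at
m = 0 because h_0 = 1. -/
theorem shiftHom_amp (n : ℤ) (m : ℕ) : shiftHom (amp R n m) = Polynomial.C (amp R n m)
    + (shiftHom (hZ R n) * Polynomial.C (hZ R m) - Polynomial.C (hZ R n) * shiftHom (hZ R m)) := by
  induction m generalizing n with
  | zero => simp [amp_zero, hZ_zero]
  | succ m ih =>
    have h1 : amp R n (m + 1) = hZ R n * hZ R (m + 1) - hZ R (n + 1) * hZ R m
      - amp R (n + 1) m := by rw [← amp_succ]; ring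
    have h2 := shiftHom_hZ_succ R n
    have h3 := shiftHom_hZ_succ R m
    rw [h1]
    simp only [map_sub, map_mul, ih, Nat.cast_add, Nat.cast_one]
    linear_combination (shiftHom (hZ R n) + Polynomial.C (hZ R n)) * h3
      - (shiftHom (hZ R m) + Polynomial.C (hZ R m)) * h2

/-- The vector obtained by applying the modes with the given indices to the vacuum. -/
def fock : List ℕ → MvPolynomial ℕ R
  | [] => 1
  | n :: l => vop R n (fock l)

theorem pairing_contr (n : ℤ) (F : List ℕ → MvPolynomial ℕ R) (l : List ℕ) :
    pairing R n (contr (fun x : ℕ => shiftHom (hZ R x)) (fun l => Polynomial.C (F l)) l)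
      = contr (amp R n) F l :=
  contr_map (pairing R n).toAddMonoidHom fun _ _ _ _ => pairing_mul_C R n _ _

theorem C_contr {S : Type*} [CommRing S] (u : ℕ → S) (F : List ℕ → S) (l : List ℕ) :
    contr (fun x => Polynomial.C (u x)) (fun l => Polynomial.C (F l)) l
      = Polynomial.C (contr u F l) :=
  (contr_map (Polynomial.C : _ →+* _).toAddMonoidHom
    (u := u) (F := F) fun _ _ _ _ => Polynomial.C_mul).symm

theorem eval_zero_shiftHom (f : MvPolynomial ℕ R) : (shiftHom f).eval 0 = f := by
  have h1 : ((Polynomial.aeval (0 : MvPolynomial ℕ R)).restrictScalars R).comp shiftHom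
      = AlgHom.id R (MvPolynomial ℕ R) := by
    ext i
    simp [shiftHom]
  exact DFunLike.congr_fun h1 f

/-- Wick's theorem with the spectral parameter kept: pairing the shifted h_x gives `amp R n x`, so
one formula describes all modes φ_n on a word at once. Prepending a letter exchanges the parities,
hence the joint induction. The surplus terms vanish because contractions anticommute and square to
zero. -/
theorem shiftHom_fock (l : List ℕ) :
    (Odd l.length → shiftHom (fock R l) =
      contr (fun x : ℕ => shiftHom (hZ R x)) (fun l => Polynomial.C (fock R l)) l) ∧
    (Even l.length → shiftHom (fock R l) = Polynomial.C (fock R l) +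
      contr (fun x : ℕ => shiftHom (hZ R x)) (fun l => Polynomial.C
        (contr (fun x : ℕ => hZ R x) (fock R) l)) l) := by
  induction hl : l.length using Nat.strong_induction_on generalizing l with
  | _ N ih =>
    subst hl
    rcases l with _ | ⟨n, l⟩
    · simp [fock, contr_nil]
    have hodd : ∀ l' : List ℕ, l'.length ≤ l.length → Odd l'.length →
        fock R (n :: l') = contr (amp R n) (fock R) l' := fun l' hl' ho => by
      rw [fock, vop_apply, (ih _ (by simp; omega) l' rfl).1 ho, pairing_contr]
    set u : ℕ → Polynomial (MvPolynomial ℕ R) := fun x : ℕ => shiftHom (hZ R x) with hu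
    set v : ℕ → Polynomial (MvPolynomial ℕ R) := fun x : ℕ => Polynomial.C (hZ R x) with hv
    set G : List ℕ → Polynomial (MvPolynomial ℕ R) := fun l => Polynomial.C (fock R l) with hG
    have hC : ∀ l, Polynomial.C (contr (fun x : ℕ => hZ R x) (fock R) l) = contr v G l :=
      fun l => (C_contr _ _ l).symm
    simp only [hC] at ih ⊢
    have heven : ∀ l' : List ℕ, l'.length ≤ l.length → Even l'.length →
        shiftHom (fock R l') = G l' + contr u (contr v G) l' := fun l' hl' he =>
      (ih _ (by simp; omega) l' rfl).2 he
    constructor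
    · intro ho
      have he : Even l.length := by simpa [Nat.odd_add_one] using ho
      -- An odd word is its own contraction with h; the shift is then applied to this expansion as a
      -- ring homomorphism.
      have h1 : fock R (n :: l) = contr (fun x : ℕ => hZ R x) (fock R) (n :: l) := by
        rw [contr_cons, contr_congr _ (F := fun l' => fock R (n :: l')) (G := contr (amp R n) (fock R))
          fun l' hl' => hodd l' (by omega) (by rw [← hl'] at he; grind), contr_contr,
          fock, vop_apply, heven l le_rfl he, map_add, pairing_C]
        have h2 : contr v G = fun l => Polynomial.C (contr (fun x : ℕ => hZ R x) (fock R) l) :=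
          funext fun l => (hC l).symm
        rw [h2, pairing_contr]
        ring
      rw [h1]
      have h2 := contr_map (shiftHom (R := R) : _ →+* _).toAddMonoidHom
        (u := fun x : ℕ => hZ R x) (u' := u) (F := fock R)
        (F' := fun l => G l + contr u (contr v G) l) (l := n :: l) fun x _ l' hl' => by
          have h3 := heven l' (by simpa using hl'.le) (by
            simp only [List.length_cons, add_left_inj] at hl'; rwa [hl'])
          rw [← h3]
          exact map_mul shiftHom _ _
      refine h2.trans ?_
      rw [contr_add, contr_contr_self, add_zero]
    · intro he
      have ho : Odd l.length := by simpa [Nat.even_add_one] using he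
      rw [hodd l le_rfl ho]
      -- Each summand is shifted in both factors: `shiftHom_amp` treats the amplitude, and induction
      -- treats the remaining even word.
      have h2 := contr_map (shiftHom (R := R) : _ →+* _).toAddMonoidHom
        (u := amp R n) (u' := fun x => Polynomial.C (amp R n x) + (u n * v x + (-v n) * u x))
        (F := fock R) (F' := fun l => G l + contr u (contr v G) l) (l := l) fun x _ l' hl' => by
          rw [← heven l' (by omega) (by rw [← hl'] at ho; grind)]
          refine (map_mul shiftHom _ _).trans ?_
          rw [shiftHom_amp]
          simp only [hu, hv]
          ring
      refine h2.trans ?_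
      have h3 : contr (fun x => Polynomial.C (amp R n x)) G = fun l =>
          Polynomial.C (contr (amp R n) (fock R) l) := funext fun l => C_contr _ _ l
      have h4 : contr u (contr v G) = fun l => -contr v (contr u G) l :=
        funext fun l => contr_contr u v G l
      have h5 : contr v (contr u (contr v G)) l = 0 := by
        rw [h4, contr_neg, contr_contr_self, neg_zero]
      have h6 : contr u (contr v G) (n :: l) = u n * contr v G l - v n * contr u G l
          + contr (fun x => Polynomial.C (amp R n x)) (contr u (contr v G)) l := by
        have h7 : ∀ l', l'.length + 1 = l.length → contr v G (n :: l') = v n * G l'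
            - contr v (contr (fun x => Polynomial.C (amp R n x)) G) l' := fun l' hl' => by
          rw [contr_cons]
          congr 1
          refine contr_congr _ fun l'' hl'' => ?_
          rw [h3, hG]
          simp only
          rw [hodd l'' (by omega) (by rw [← hl', ← hl''] at ho; grind)]
        rw [contr_cons, contr_congr u h7, contr_sub, contr_mul_left]
        have h8 : contr v (contr (fun x => Polynomial.C (amp R n x)) G) =
          fun l => -contr (fun x => Polynomial.C (amp R n x)) (contr v G) l :=
            funext fun l => contr_contr _ _ _ _
        rw [h8, contr_neg, contr_contr u]
        ring
      rw [h6, contr_add_left, contr_add_left, contr_mul_left', contr_mul_left', contr_add,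
        contr_add, contr_add, h5, contr_contr_self, h3]
      ring

/-- At k⁻¹ = 0 the shift is the identity. -/
theorem fock_eq_contr_of_odd {l : List ℕ} (hl : Odd l.length) :
    fock R l = contr (fun x : ℕ => hZ R x) (fock R) l := by
  have h1 := congrArg (Polynomial.eval 0) ((shiftHom_fock R l).1 hl)
  rw [eval_zero_shiftHom] at h1
  refine h1.trans ?_
  refine contr_map (Polynomial.evalRingHom (0 : MvPolynomial ℕ R)).toAddMonoidHom
    fun x _ l' _ => ?_
  simp [eval_zero_shiftHom]

theorem vop_fock (n : ℤ) (l : List ℕ) : vop R n (fock R l) =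
    (if Even l.length then hZ R n * fock R l else 0) + contr (amp R n) (fock R) l := by
  split_ifs with hl
  · rw [vop_apply, (shiftHom_fock R l).2 hl, map_add, pairing_C, pairing_contr, mul_comm]
    congr 1
    refine contr_congr _ fun l' hl' => (fock_eq_contr_of_odd R ?_).symm
    rw [← hl'] at hl
    grind
  · rw [vop_apply, (shiftHom_fock R l).1 (Nat.not_even_iff_odd.mp hl), pairing_contr, zero_add]

end Fermions

/-! ### Changing the entries or the base ring of a Pfaffian -/

section Congruence

variable {S : Type*} [CommRing S]

theorem contr_congr_sublist {u v : ℕ → S} {F G : List ℕ → S} {l : List ℕ}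
    (huv : ∀ x ∈ l, u x = v x) (h : ∀ l', l'.Sublist l → l'.length + 1 = l.length → F l' = G l') :
    contr u F l = contr v G l := by
  induction l generalizing F G with
  | nil => rfl
  | cons x l ih =>
    rw [contr_cons, contr_cons, huv x (by simp), h l (List.sublist_cons_self x l) rfl,
      ih (fun y hy => huv y (by simp [hy]))
        fun l' hl' hlen => h _ (hl'.cons_cons x) (by simp [hlen])]

/-- Expansion along first rows uses only entries above the diagonal; this hides the discrepancy
between `amp` and P at (0, 0). -/
theorem pf_congr {a b : ℕ → ℕ → S} {l : List ℕ} (h : l.Pairwise fun x y => a x y = b x y) :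
    pf a l = pf b l := by
  induction hn : l.length using Nat.strong_induction_on generalizing l with
  | _ n ih =>
    rcases l with _ | ⟨x, l⟩
    · rw [pf_nil, pf_nil]
    · rw [pf_cons, pf_cons]
      rw [List.pairwise_cons] at h
      refine contr_congr_sublist h.1 fun l' hl' hlen => ih _ ?_ (h.2.sublist hl') rfl
      simp only [List.length_cons] at hn
      omega

theorem map_pf {T : Type*} [CommRing T] (φ : S →+* T) (a : ℕ → ℕ → S) (l : List ℕ) :
    φ (pf a l) = pf (fun x y => φ (a x y)) l := by
  induction hn : l.length using Nat.strong_induction_on generalizing l with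
  | _ n ih =>
    rcases l with _ | ⟨x, l⟩
    · rw [pf_nil, pf_nil, map_one]
    · rw [pf_cons, pf_cons]
      refine contr_map φ.toAddMonoidHom fun y _ l' hl' => (map_mul φ _ _).trans ?_
      simp only [List.length_cons] at hn
      rw [ih _ (by omega) l' rfl]

end Congruence

/-! ### Clifford relations on words and the action of the modes on Q-polynomials -/

section Fermions

variable (R : Type*) [CommRing R] [Algebra ℂ R]

/-- The substitution `t ↦ t/2`. -/
def halve : MvPolynomial ℕ ℂ →ₐ[ℂ] MvPolynomial ℕ R :=
  MvPolynomial.aeval fun i => MvPolynomial.C (algebraMap ℂ R (1 / 2)) * MvPolynomial.X i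

theorem halve_q (n : ℕ) : halve R (q n) = hZ R n := by
  rw [halve, aeval_q, hZ_natCast]
  congr 2
  ext1 i
  rw [Algebra.smul_def, ← mul_assoc, MvPolynomial.algebraMap_apply, ← MvPolynomial.C_mul,
    ← map_mul]
  simp

theorem amp_eq_halve_P (n m : ℕ) :
    amp R n m = halve R (P n m) + if n = 0 ∧ m = 0 then 1 else 0 := by
  induction m generalizing n with
  | zero =>
    rw [amp_zero, P_right, map_sub, halve_q]
    by_cases hn : n = 0 <;> simp [hn]
  | succ m ih =>
    have h1 := amp_succ R n m
    have h2 := congrArg (halve R) (P_add n m)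
    have h3 := ih (n + 1)
    simp only [map_add, map_sub, map_mul, halve_q] at h2
    push_cast at h1 h2 h3
    simp only [Nat.add_eq_zero_iff, one_ne_zero, and_false, false_and, if_false, add_zero] at h3 ⊢
    linear_combination h1 - h2 - h3

/-- The right-hand sides of `amp_succ` at (n, m) and (m, n) cancel, so the symmetrized amplitude
only changes sign along n + m constant and is read off at m = 0. -/
theorem amp_add_amp (n m : ℕ) : amp R n m + amp R m n = if n + m = 0 then 2 else 0 := by
  induction m generalizing n with
  | zero =>
    have h1 : amp R n 0 = halve R (P n 0) + if n = 0 ∧ (0 : ℕ) = 0 then 1 else 0 :=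
      amp_eq_halve_P R n 0
    rw [h1, amp_eq_halve_P R 0 n, P_right, P_left]
    by_cases hn : n = 0
    · subst hn
      simp [q_zero]
      norm_num
    · simp [hn]
  | succ m ih =>
    have h1 := amp_succ R n m
    have h2 := amp_succ R m n
    have h3 := ih (n + 1)
    push_cast at h1 h2 h3 ⊢
    simp only [Nat.add_eq_zero_iff, one_ne_zero, and_false, false_and, if_false] at h3 ⊢
    linear_combination h1 + h2 - h3

/-- The recursion moves both indices towards 0. Terms in h enter only in the step from −1 to 0,
where `amp_add_amp` evaluates them. -/
theorem amp_neg (n x : ℕ) (hn : n ≠ 0) :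
    amp R (-n) x = if x = n then 2 * (-1) ^ n else 0 := by
  induction x generalizing n with
  | zero => rw [amp_zero, hZ_of_neg R (by omega), if_neg hn.symm]
  | succ x ih =>
    obtain ⟨n, rfl⟩ := Nat.exists_eq_succ_of_ne_zero hn
    have h1 := amp_succ R (-(n + 1 : ℕ)) x
    rw [hZ_of_neg R (n := -(n + 1 : ℕ)) (by omega),
      show (-(n + 1 : ℕ) + 1 : ℤ) = -n by push_cast; ring] at h1
    rw [Nat.succ_eq_add_one, eq_sub_of_add_eq h1]
    rcases Nat.eq_zero_or_pos n with rfl | hn'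
    · have h2 := amp_add_amp R 0 x
      rw [Nat.cast_zero] at h2
      have h3 := amp_zero R x
      rw [Nat.cast_zero, neg_zero, hZ_zero]
      rw [h3, zero_add] at h2
      by_cases hx : x = 0 <;> simp [hx] at h2 ⊢ <;> linear_combination -h2
    · rw [ih n hn'.ne', hZ_of_neg R (n := -n) (by omega)]
      by_cases hx : x = n <;> simp [hx, pow_succ]

theorem fock_cons (n : ℕ) (l : List ℕ) : fock R (n :: l) =
    (if Even l.length then hZ R n * fock R l else 0) + contr (amp R n) (fock R) l :=
  vop_fock R n l

/-- In the sum of the two orders the double contractions cancel by `contr_contr`, and the terms with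
h_x and h_y present for odd `l` are antisymmetric. -/
theorem fock_cons_cons (x y : ℕ) (l : List ℕ) :
    fock R (x :: y :: l) + fock R (y :: x :: l) = (amp R x y + amp R y x) * fock R l := by
  rcases Nat.even_or_odd l.length with he | ho
  · have key : ∀ x y : ℕ, fock R (x :: y :: l) = amp R x y * fock R l
        - contr (amp R x) (contr (amp R y) (fock R)) l := fun x y => by
      rw [fock_cons, if_neg (by simpa [Nat.even_add_one] using he), contr_cons, zero_add]
      congr 1
      refine contr_congr _ fun l' hl' => ?_
      rw [fock_cons, if_neg (by rw [← hl'] at he; grind), zero_add]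
    rw [key, key, contr_contr]
    ring
  · have key : ∀ x y : ℕ, fock R (x :: y :: l) = amp R x y * fock R l
        - contr (amp R x) (contr (amp R y) (fock R)) l
        + (hZ R x * contr (amp R y) (fock R) l - hZ R y * contr (amp R x) (fock R) l) :=
      fun x y => by
      have h1 : contr (amp R x) (fun l' => fock R (y :: l')) l
          = contr (amp R x) (fun l' => hZ R y * fock R l' + contr (amp R y) (fock R) l') l :=
        contr_congr _ fun l' hl' => by
          rw [fock_cons, if_pos (by rw [← hl'] at ho; grind)]
      rw [fock_cons, if_pos (by simpa [Nat.even_add_one] using ho), contr_cons, h1, contr_add,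
        contr_mul_left, fock_cons R y l, if_neg (Nat.not_even_iff_odd.mpr ho)]
      ring
    rw [key, key, contr_contr]
    ring

theorem fock_append (l₁ : List ℕ) {l l' : List ℕ} {c : R} (h : fock R l = c • fock R l') :
    fock R (l₁ ++ l) = c • fock R (l₁ ++ l') := by
  induction l₁ with
  | nil => exact h
  | cons x l₁ ih => rw [List.cons_append, List.cons_append, fock, fock, ih, map_smul]

theorem fock_swap (l₁ l₂ : List ℕ) {x y : ℕ} (hxy : y ≠ x) :
    fock R (l₁ ++ y :: x :: l₂) = -fock R (l₁ ++ x :: y :: l₂) := by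
  rw [fock_append R l₁ (c := -1) (l' := x :: y :: l₂), neg_smul, one_smul]
  have h1 := fock_cons_cons R x y l₂
  rw [amp_add_amp, if_neg (by omega), zero_mul] at h1
  rw [neg_smul, one_smul]
  linear_combination h1

theorem isUnit_two : IsUnit (2 : R) := by
  have h1 := (IsUnit.mk0 (2 : ℂ) two_ne_zero).map (algebraMap ℂ R)
  rwa [map_ofNat] at h1

/-- Index 0 is excluded because its anticommutator with itself is 2. -/
theorem fock_cons_cons_self {x : ℕ} (hx : x ≠ 0) (l : List ℕ) : fock R (x :: x :: l) = 0 := by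
  have h1 := fock_cons_cons R x x l
  rw [amp_add_amp, if_neg (by omega), zero_mul, ← two_mul] at h1
  exact ((isUnit_two (MvPolynomial ℕ R)).mul_right_eq_zero).mp h1

/-- The mode φ_0 fixes the vacuum, which accounts for the extra row 0 when the number of parts is
odd. -/
theorem fock_append_zero (l : List ℕ) : fock R (l ++ [0]) = fock R l := by
  have h1 : fock R [0] = (1 : R) • fock R [] := by
    simp only [fock]
    rw [one_smul, vop_apply, map_one, ← map_one Polynomial.C, pairing_C]
    simp [hZ_zero]
  rw [fock_append R l h1, one_smul, List.append_nil]

theorem fock_eq_pf {l : List ℕ} (hl : Even l.length) :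
    fock R l = pf (fun x y => amp R x y) l := by
  induction hn : l.length using Nat.strong_induction_on generalizing l with
  | _ n ih =>
    rcases l with _ | ⟨x, l⟩
    · rw [pf_nil, fock]
    · have ho : Odd l.length := by simpa [Nat.even_add_one] using hl
      rw [pf_cons, fock_cons, if_neg (Nat.not_even_iff_odd.mpr ho), zero_add]
      refine contr_congr _ fun l' hl' => ih _ ?_ (by rw [← hl'] at ho; grind) rfl
      simp only [List.length_cons] at hn
      omega

/-- The scalar `2^{-1/2}`. -/
def invSqrtTwo : R := algebraMap ℂ R ((Real.sqrt 2 : ℝ) : ℂ)⁻¹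

theorem two_mul_invSqrtTwo_sq : 2 * invSqrtTwo R * invSqrtTwo R = 1 := by
  rw [invSqrtTwo, mul_assoc, ← map_mul, ← mul_inv, ← Complex.ofReal_mul,
    Real.mul_self_sqrt zero_le_two]
  have h2 : (2 : R) = algebraMap ℂ R 2 := (map_ofNat _ 2).symm
  rw [h2, ← map_mul]
  simp

/-- The polynomial `Q_λ(t/2)`, where the parts of `λ` are the nonzero elements of `s`. -/
def halfQ (s : Finset ℕ) : MvPolynomial ℕ R := Qat (algebraMap ℂ R (1 / 2)) (drop0 s)

/-- Wick's theorem for the rows of λ. They are strictly decreasing, so the exceptional pair (0, 0)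
never occurs. -/
theorem halfQ_eq {s : Finset ℕ} (hs : 0 ∉ s) :
    halfQ R s = MvPolynomial.C (invSqrtTwo R ^ s.card) * fock R (sortD s) := by
  have h0 : drop0 s = ⟨s, hs⟩ := drop0_self ⟨s, hs⟩
  have h1 : halfQ R s = halve R (Q ⟨s, hs⟩) := by rw [halfQ, h0]; rfl
  have hrows : StrictPartition.rows ⟨s, hs⟩ = sortD s ++ if Odd s.card then [0] else [] := rfl
  rw [h1]
  refine (map_mul (halve R) _ _).trans ?_
  congr 1
  · rw [halve, MvPolynomial.aeval_C, MvPolynomial.algebraMap_apply, map_pow, invSqrtTwo]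
  · have h2 : fock R (sortD s) = fock R (StrictPartition.rows ⟨s, hs⟩) := by
      rw [hrows]
      split_ifs
      · rw [fock_append_zero]
      · rw [List.append_nil]
    have h3 : (StrictPartition.rows ⟨s, hs⟩).Pairwise (· > ·) := by
      rw [hrows]
      have h4 : (sortD s).Pairwise (· > ·) := Finset.sortedGT_sort s |>.pairwise
      split_ifs
      · rw [List.pairwise_append]
        refine ⟨h4, by simp, fun a ha b hb => ?_⟩
        simp only [List.mem_singleton] at hb
        simp only [Finset.mem_sort] at ha
        exact hb ▸ Nat.pos_of_ne_zero fun h => hs (h ▸ ha)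
      · simpa using h4
    have h5 : Even (StrictPartition.rows ⟨s, hs⟩).length := by
      rw [hrows]
      split_ifs with h <;> simp <;> grind
    rw [h2, fock_eq_pf R h5]
    refine (map_pf (halve R).toRingHom P _).trans (pf_congr (h3.imp fun {a b} hab => ?_))
    rw [amp_eq_halve_P, if_neg (by omega), add_zero]
    rfl

/-- Creation; the factor 2 · 2^{−1/2} compensates the normalization 2^{−1/2} of the new part. -/
theorem vop_natCast_halfQ {n : ℕ} (hn : n ≠ 0) {s : Finset ℕ} (hs : 0 ∉ s) :
    vop R n (halfQ R s) = if n ∈ s then 0 else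
      (2 * invSqrtTwo R * sgn R n s) • halfQ R (insert n s) := by
  rw [halfQ_eq R hs, ← MvPolynomial.smul_eq_C_mul, map_smul]
  change _ • fock R (n :: sortD s) = _
  split_ifs with h
  · rw [cons_sortD_of_mem (fun l₁ l₂ y hy => fock_swap R l₁ l₂ hy)
      (fun l => fock_cons_cons_self R hn l) h, smul_zero]
  · rw [cons_sortD_of_notMem (fun l₁ l₂ y hy => fock_swap R l₁ l₂ hy) h,
      halfQ_eq R (by simp [hs, hn.symm]), Finset.card_insert_of_notMem h,
      MvPolynomial.smul_eq_C_mul, MvPolynomial.smul_eq_C_mul, ← mul_assoc, ← mul_assoc]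
    congr 1
    have h1 : sgn (MvPolynomial ℕ R) n s = MvPolynomial.C (sgn R n s) := by simp [sgn]
    rw [h1, ← MvPolynomial.C_mul, ← MvPolynomial.C_mul]
    congr 1
    linear_combination -(invSqrtTwo R ^ s.card * sgn R n s) * two_mul_invSqrtTwo_sq R

/-- Annihilation: h vanishes at negative index, and `amp_neg` leaves at most one term of the
contraction. -/
theorem vop_neg_halfQ {n : ℕ} (hn : n ≠ 0) {s : Finset ℕ} (hs : 0 ∉ s) :
    vop R (-n) (halfQ R s) = if n ∈ s then
      (2 * invSqrtTwo R * (-1) ^ n * sgn R n s) • halfQ R (s.erase n) else 0 := by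
  rw [halfQ_eq R hs, ← MvPolynomial.smul_eq_C_mul, map_smul, vop_fock,
    hZ_of_neg R (n := -n) (by omega), zero_mul, ite_self, zero_add, contr_sortD]
  simp only [amp_neg R n _ hn]
  split_ifs with h
  · rw [Finset.sum_eq_single_of_mem n h (fun b _ hb => by simp [hb]), if_pos rfl,
      halfQ_eq R (fun h0 => hs (Finset.mem_of_mem_erase h0)), ← Finset.card_erase_add_one h,
      MvPolynomial.smul_eq_C_mul, MvPolynomial.smul_eq_C_mul]
    have h1 : sgn (MvPolynomial ℕ R) n s = MvPolynomial.C (sgn R n s) := by simp [sgn]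
    simp only [map_mul, map_pow, map_ofNat, map_neg, map_one, h1]
    ring
  · rw [Finset.sum_eq_zero, smul_zero]
    intro x hx
    rw [if_neg (fun hxn : x = n => h (hxn ▸ hx))]
    ring

/-- The index 0 passes every part on its way to the vacuum, which it fixes. -/
theorem vop_zero_halfQ {s : Finset ℕ} (hs : 0 ∉ s) :
    vop R 0 (halfQ R s) = (-1 : R) ^ s.card • halfQ R s := by
  rw [halfQ_eq R hs, ← MvPolynomial.smul_eq_C_mul, map_smul, smul_comm]
  congr 1
  have h1 := move_front (F := fock R) (x := 0) (sortD s) [] (fun l₁ l₂ y hy => fock_swap R l₁ l₂ hy)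
    (fun y hy h0 => hs (by simpa [h0] using hy))
  rw [fock_append_zero, List.append_nil, Finset.length_sort] at h1
  have h2 : fock R (0 :: sortD s) = vop R 0 (fock R (sortD s)) := rfl
  rw [← h2, h1, MvPolynomial.smul_eq_C_mul, ← mul_assoc]
  simp [← mul_pow]

theorem isUnit_sgn {S : Type*} [CommRing S] (x : ℕ) (s : Finset ℕ) : IsUnit (sgn S x s) :=
  IsUnit.of_mul_eq_one _ (sgn_mul_self x s)

/-- The mode φ_{−(M+1)} kills the terms with parts at most M and, up to a unit, strips M + 1 from
the others, so the two groups separate and induction applies to each. -/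
theorem halfQ_linearIndependent (M : ℕ) (K : Finset ℕ → R)
    (hK : ∑ s ∈ (Finset.Icc 1 M).powerset, K s • halfQ R s = 0) :
    ∀ s ∈ (Finset.Icc 1 M).powerset, K s = 0 := by
  induction M generalizing K with
  | zero =>
    have h1 : halfQ R ∅ = 1 := by rw [halfQ_eq R (by simp)]; simp [fock]
    have h2 : K ∅ = 0 := by
      rw [Finset.Icc_eq_empty (by omega), Finset.powerset_empty, Finset.sum_singleton, h1] at hK
      simpa [MvPolynomial.smul_eq_C_mul] using hK
    intro s hs
    obtain rfl : s = ∅ := by simpa using hs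
    exact h2
  | succ M ih =>
    have h0 : ∀ s ∈ (Finset.Icc 1 M).powerset, 0 ∉ s ∧ M + 1 ∉ s := fun s hs => by
      rw [Finset.mem_powerset] at hs
      exact ⟨fun h => by simpa using hs h, fun h => by simpa using hs h⟩
    have h1 : Finset.Icc 1 (M + 1) = insert (M + 1) (Finset.Icc 1 M) := by
      ext x; simp only [Finset.mem_Icc, Finset.mem_insert]; omega
    rw [h1, Finset.sum_powerset_insert (by simp)] at hK
    have h2 : ∀ s ∈ (Finset.Icc 1 M).powerset, K (insert (M + 1) s) = 0 := by
      have h3 := congrArg (vop R (-(M + 1 : ℕ))) hK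
      rw [map_add, map_sum, map_sum, map_zero, Finset.sum_eq_zero, zero_add] at h3
      · have h4 := ih (fun s => K (insert (M + 1) s) *
          (2 * invSqrtTwo R * (-1) ^ (M + 1) * sgn R (M + 1) s)) (by
            rw [← h3]
            refine Finset.sum_congr rfl fun s hs => ?_
            rw [map_smul, vop_neg_halfQ R (by omega) (by simp [h0 s hs]), if_pos (by simp),
              Finset.erase_insert (h0 s hs).2, smul_smul, sgn_insert_self])
        intro s hs
        have h5 : IsUnit (2 * invSqrtTwo R * (-1) ^ (M + 1) * sgn R (M + 1) s) :=
          ((IsUnit.of_mul_eq_one _ (two_mul_invSqrtTwo_sq R)).mul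
            (isUnit_one.neg.pow _)).mul (isUnit_sgn _ _)
        exact h5.mul_left_eq_zero.mp (h4 s hs)
      · intro s hs
        rw [map_smul, vop_neg_halfQ R (by omega) (h0 s hs).1, if_neg (h0 s hs).2, smul_zero]
    have h3 := ih K (by
      rw [← hK, left_eq_add]
      exact Finset.sum_eq_zero fun s hs => by rw [h2 s hs, zero_smul])
    intro s hs
    rw [h1, Finset.mem_powerset] at hs
    by_cases hM : M + 1 ∈ s
    · rw [← Finset.insert_erase hM]
      exact h2 _ (Finset.mem_powerset.mpr (Finset.subset_insert_iff.mp hs))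
    · exact h3 s (Finset.mem_powerset.mpr ((Finset.subset_insert_iff_of_notMem hM).mp hs))

end Fermions

/-! ### Truncation of power series -/

section Truncation

variable {R : Type*} [CommRing R] {σ τ : Type*}

/-- Two power series have the same coefficients in weights up to `M`. -/
def AgreeTo (w : σ → ℕ) (M : ℕ) (F G : MvPowerSeries σ R) : Prop :=
  ∀ d, Finsupp.weight w d ≤ M → F.coeff d = G.coeff d

theorem AgreeTo.mul {w : σ → ℕ} {M : ℕ} {F G F' G' : MvPowerSeries σ R} (h : AgreeTo w M F G)
    (h' : AgreeTo w M F' G') : AgreeTo w M (F * F') (G * G') := by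
  classical
  intro d hd
  rw [MvPowerSeries.coeff_mul, MvPowerSeries.coeff_mul]
  refine Finset.sum_congr rfl fun x hx => ?_
  rw [← Finset.HasAntidiagonal.mem_antidiagonal.mp hx, map_add] at hd
  rw [h _ (by omega), h' _ (by omega)]

/-- When each variable is replaced by a series of order at least its weight, a monomial reaches only
weights at least its own. -/
theorem AgreeTo.subst {w : σ → ℕ} {w' : τ → ℕ} {M : ℕ} {F G : MvPowerSeries σ R}
    (h : AgreeTo w M F G) {a : σ → MvPowerSeries τ R} (ha : MvPowerSeries.HasSubst a)
    (hw : ∀ i, (w i : ℕ∞) ≤ (a i).weightedOrder w') :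
    AgreeTo w' M (F.subst a) (G.subst a) := by
  intro e he
  rw [MvPowerSeries.coeff_subst ha, MvPowerSeries.coeff_subst ha]
  refine finsum_congr fun d => ?_
  by_cases h0 : MvPowerSeries.coeff e (d.prod fun s n => a s ^ n) = 0
  · rw [h0, smul_zero, smul_zero]
  · rw [h d]
    refine le_trans ?_ he
    have h1 := MvPowerSeries.weightedOrder_le w' h0
    have h2 : ((Finsupp.weight w d : ℕ) : ℕ∞)
        ≤ (d.prod fun s n => a s ^ n).weightedOrder w' := by
      refine le_trans ?_ (MvPowerSeries.le_weightedOrder_prod ..)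
      rw [Finsupp.weight_apply, Finsupp.sum, Nat.cast_sum]
      refine Finset.sum_le_sum fun i _ => le_trans ?_ (MvPowerSeries.le_weightedOrder_pow ..)
      rw [smul_eq_mul, Nat.cast_mul, nsmul_eq_mul]
      exact mul_le_mul_right (hw i) _
    exact_mod_cast h2.trans h1

theorem AgreeTo.rename {w : σ → ℕ} {w' : τ → ℕ} {M : ℕ} {F G : MvPowerSeries σ R}
    (h : AgreeTo w M F G) (f : σ ↪ τ) (hf : ∀ i, w' (f i) = w i) :
    AgreeTo w' M (MvPowerSeries.rename f F) (MvPowerSeries.rename f G) := by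
  classical
  rw [MvPowerSeries.rename_eq_subst, MvPowerSeries.rename_eq_subst]
  refine h.subst (MvPowerSeries.HasSubst.X_comp _) fun i => ?_
  refine MvPowerSeries.nat_le_weightedOrder _ fun d hd => ?_
  rw [Function.comp_apply, MvPowerSeries.coeff_X, if_neg]
  rintro rfl
  rw [Finsupp.weight_single, hf] at hd
  simp at hd

end Truncation

/-! ### Weight bounds for the residue, and the shifted product of a polynomial -/

section Residue

variable {R : Type*} [CommRing R] [Algebra ℂ R]

/-- The weights of the variables `k⁻¹`, `t`, `t'`. -/
def shiftWt : Option (ℕ ⊕ ℕ) → ℕ := fun o => o.elim 1 (Sum.elim wt wt)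

theorem le_weightedOrder_shift {R : Type*} [CommRing R] (x : ℕ ⊕ ℕ) (c : R) :
    ((Sum.elim wt wt x : ℕ) : ℕ∞) ≤ (MvPowerSeries.X (some x) + MvPowerSeries.C c *
      MvPowerSeries.X none ^ (Sum.elim wt wt x) :
        MvPowerSeries (Option (ℕ ⊕ ℕ)) R).weightedOrder shiftWt := by
  classical
  refine MvPowerSeries.nat_le_weightedOrder _ fun d hd => ?_
  rw [map_add, MvPowerSeries.coeff_X, MvPowerSeries.coeff_C_mul, MvPowerSeries.coeff_X_pow,
    if_neg, if_neg]
  · simp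
  all_goals
    rintro rfl
    rw [Finsupp.weight_single] at hd
    simp [shiftWt] at hd

theorem AgreeTo.shiftedProduct {M : ℕ} {F G : MvPowerSeries ℕ R} (h : AgreeTo wt M F G) :
    AgreeTo shiftWt M (shiftedProduct F) (shiftedProduct G) := by
  refine (h.subst hasSubst_shiftLeft fun i => ?_).mul (h.subst hasSubst_shiftRight fun i => ?_)
  · have := le_weightedOrder_shift (R := R) (Sum.inl i) (-(algebraMap ℂ R (2 / (2 * i + 1))))
    simpa [shiftLeft, sub_eq_add_neg, wt] using this
  · exact le_weightedOrder_shift (Sum.inr i) _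

/-- Giving k⁻¹ weight 1, the coefficient of k⁻ⁿ costs n extra units of weight, and h_n(t − t')
supplies exactly n. -/
theorem AgreeTo.residue {M : ℕ} {F G : MvPowerSeries ℕ R} (h : AgreeTo wt M F G) :
    AgreeTo (Sum.elim wt wt) M (residue F) (residue G) := by
  classical
  intro d hd
  refine finsum_congr fun n => ?_
  rw [MvPowerSeries.coeff_mul, MvPowerSeries.coeff_mul]
  refine Finset.sum_congr rfl fun x hx => ?_
  by_cases h0 : (hDiff R n).coeff x.1 = 0
  · rw [MvPolynomial.coeff_coe, h0, zero_mul, zero_mul]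
  · congr 1
    apply h.shiftedProduct
    rw [← Finset.HasAntidiagonal.mem_antidiagonal.mp hx, map_add, hDiff_homog R n h0] at hd
    rw [map_add, Finsupp.weight_single]
    have h1 : Finsupp.weight shiftWt (x.2.mapDomain some) = Finsupp.weight (Sum.elim wt wt) x.2 := by
      rw [Finsupp.weight_apply, Finsupp.weight_apply, Finsupp.sum_mapDomain_index] <;>
        simp [shiftWt, add_mul]
    rw [h1]
    simp only [shiftWt, Option.elim, smul_eq_mul, mul_one]
    omega

/-! ### The residue of a polynomial -/

theorem coeff_aeval_neg_X {S : Type*} [CommRing S] (p : Polynomial S) (n : ℕ) :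
    (Polynomial.aeval (-Polynomial.X : Polynomial S) p).coeff n = p.coeff n * (-1) ^ n := by
  have h1 : Polynomial.aeval (-Polynomial.X : Polynomial S) p
      = p.comp (Polynomial.C (-1) * Polynomial.X) := by
    rw [map_neg, map_one, neg_one_mul]
    rfl
  rw [h1, Polynomial.comp_C_mul_X_coeff]

theorem neg_pow_odd {S : Type*} [CommRing S] (x : S) (i : ℕ) :
    (-x) ^ (2 * i + 1) = -x ^ (2 * i + 1) :=
  (odd_two_mul_add_one i).neg_pow x

/-- The shift t' + 2[k⁻¹] is t' − 2[k⁻¹] with k⁻¹ negated, since only odd powers occur; this is the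
source of the signs. -/
theorem shiftedProductCoeff_coe (f : MvPolynomial ℕ R) (n : ℕ) :
    shiftedProductCoeff (f : MvPowerSeries ℕ R) n =
      ((∑ p ∈ Finset.HasAntidiagonal.antidiagonal n,
        MvPolynomial.rename Sum.inl ((shiftHom f).coeff p.1) *
          ((-1) ^ p.2 * MvPolynomial.rename Sum.inr ((shiftHom f).coeff p.2)) :
        MvPolynomial (ℕ ⊕ ℕ) R) : MvPowerSeries (ℕ ⊕ ℕ) R) := by
  let sl : ℕ → MvPolynomial (Option (ℕ ⊕ ℕ)) R := fun i => MvPolynomial.X (some (Sum.inl i))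
    - MvPolynomial.C (algebraMap ℂ R (2 / (2 * i + 1))) * MvPolynomial.X none ^ (2 * i + 1)
  let sr : ℕ → MvPolynomial (Option (ℕ ⊕ ℕ)) R := fun i => MvPolynomial.X (some (Sum.inr i))
    + MvPolynomial.C (algebraMap ℂ R (2 / (2 * i + 1))) * MvPolynomial.X none ^ (2 * i + 1)
  have hcoe (g : ℕ → MvPolynomial (Option (ℕ ⊕ ℕ)) R) :
      MvPolynomial.aeval (fun i => (g i : MvPowerSeries (Option (ℕ ⊕ ℕ)) R)) f
        = ((MvPolynomial.aeval g f : MvPolynomial (Option (ℕ ⊕ ℕ)) R) : MvPowerSeries _ R) := by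
    have h1 : MvPolynomial.aeval (fun i => (g i : MvPowerSeries (Option (ℕ ⊕ ℕ)) R))
        = (MvPolynomial.coeToMvPowerSeries.algHom R).comp (MvPolynomial.aeval g) := by
      ext1 i
      simp [MvPolynomial.coeToMvPowerSeries.algHom_apply]
    rw [h1]
    simp [MvPolynomial.coeToMvPowerSeries.algHom_apply]
  have hl : MvPolynomial.optionEquivLeft R _ (MvPolynomial.aeval sl f)
      = (shiftHom f).map (MvPolynomial.rename Sum.inl : _ →ₐ[R] _).toRingHom := by
    have h1 : (MvPolynomial.optionEquivLeft R _).toAlgHom.comp (MvPolynomial.aeval sl)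
        = (Polynomial.mapAlgHom (MvPolynomial.rename Sum.inl)).comp shiftHom := by
      ext1 i
      simp [sl, shiftHom, Polynomial.algebraMap_apply, MvPolynomial.algebraMap_apply]
    exact DFunLike.congr_fun h1 f
  have hr : MvPolynomial.optionEquivLeft R _ (MvPolynomial.aeval sr f)
      = Polynomial.aeval (-Polynomial.X : Polynomial (MvPolynomial (ℕ ⊕ ℕ) R))
        ((shiftHom f).map (MvPolynomial.rename (Sum.inr : ℕ → ℕ ⊕ ℕ) : _ →ₐ[R] _).toRingHom) := by
    have h1 : (MvPolynomial.optionEquivLeft R _).toAlgHom.comp (MvPolynomial.aeval sr)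
        = ((Polynomial.aeval (R := MvPolynomial (ℕ ⊕ ℕ) R)
          (-Polynomial.X : Polynomial (MvPolynomial (ℕ ⊕ ℕ) R))).restrictScalars R).comp
            ((Polynomial.mapAlgHom
              (MvPolynomial.rename (Sum.inr : ℕ → ℕ ⊕ ℕ) : _ →ₐ[R] _)).comp shiftHom) := by
      ext1 i
      have h2 : (-Polynomial.X : Polynomial (MvPolynomial (ℕ ⊕ ℕ) R)) ^ (2 * i + 1)
          = -Polynomial.X ^ (2 * i + 1) := neg_pow_odd _ i
      simp [sr, shiftHom, Polynomial.algebraMap_apply, MvPolynomial.algebraMap_apply, h2]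
      ring
    exact DFunLike.congr_fun h1 f
  have h1 : shiftedProduct (f : MvPowerSeries ℕ R)
      = ((MvPolynomial.aeval sl f * MvPolynomial.aeval sr f : MvPolynomial _ R) :
        MvPowerSeries _ R) := by
    rw [shiftedProduct, MvPowerSeries.subst_coe, MvPowerSeries.subst_coe, MvPolynomial.coe_mul,
      ← hcoe, ← hcoe]
    have h2 (i : ℕ) : ((sl i : MvPolynomial _ R) : MvPowerSeries (Option (ℕ ⊕ ℕ)) R) = shiftLeft i := by
      change MvPolynomial.coeToMvPowerSeries.ringHom (sl i) = _
      rw [map_sub]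
      simp [shiftLeft]
    have h3 (i : ℕ) : ((sr i : MvPolynomial _ R) : MvPowerSeries (Option (ℕ ⊕ ℕ)) R) = shiftRight i := by
      simp [sr, shiftRight]
    simp only [h2, h3]
  ext d
  have h2 : d.mapDomain some + Finsupp.single none n = d.optionElim n := by
    ext x
    rcases x with _ | x
    · simp [Finsupp.mapDomain_of_notMem_range]
    · simp [Finsupp.mapDomain_apply (Option.some_injective _)]
  have h3 : (shiftedProductCoeff (f : MvPowerSeries ℕ R) n).coeff d
      = (shiftedProduct (f : MvPowerSeries ℕ R)).coeff (d.optionElim n) := by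
    rw [← h2]; rfl
  rw [h3, h1, MvPolynomial.coeff_coe, MvPolynomial.coeff_coe,
    ← MvPolynomial.optionEquivLeft_coeff_coeff, map_mul, hl, hr, Polynomial.coeff_mul]
  congr 1
  refine Finset.sum_congr rfl fun p _ => ?_
  rw [coeff_aeval_neg_X, Polynomial.coeff_map, Polynomial.coeff_map]
  rw [mul_comm ((-1) ^ p.2)]
  rfl

end Residue

/-! ### The residue of a polynomial as a bilinear sum over modes -/

section Residue

variable {R : Type*} [CommRing R]

/-- `f(t) g(t')`. -/
def tens : MvPolynomial ℕ R →ₗ[R] MvPolynomial ℕ R →ₗ[R] MvPolynomial (ℕ ⊕ ℕ) R :=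
  (LinearMap.mul R (MvPolynomial (ℕ ⊕ ℕ) R)).compl₁₂
    (MvPolynomial.rename Sum.inl : _ →ₐ[R] _).toLinearMap
    (MvPolynomial.rename Sum.inr : _ →ₐ[R] _).toLinearMap

theorem tens_apply (f g : MvPolynomial ℕ R) :
    tens f g = MvPolynomial.rename Sum.inl f * MvPolynomial.rename Sum.inr g := rfl

variable [Algebra ℂ R]

theorem aeval_X_comp_h (e : ℕ → ℕ ⊕ ℕ) (n : ℕ) :
    MvPolynomial.aeval (fun i => (MvPolynomial.X (e i) : MvPolynomial (ℕ ⊕ ℕ) R)) (h n)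
      = MvPolynomial.rename e (hZ R n) := by
  rw [hZ_natCast]
  change _ = ((MvPolynomial.rename e : _ →ₐ[R] _).restrictScalars ℂ) _
  rw [← AlgHom.comp_apply]
  congr 1
  ext i
  simp

theorem hDiff_eq (n : ℕ) : hDiff R n = ∑ p ∈ Finset.HasAntidiagonal.antidiagonal n,
    (-1) ^ p.2 * tens (hZ R p.1) (hZ R p.2) := by
  rw [hDiff, aeval_sub_h]
  refine Finset.sum_congr rfl fun p _ => ?_
  rw [aeval_X_comp_h, aeval_X_comp_h, tens_apply]
  ring

theorem neg_one_pow_natAbs_sub {S : Type*} [CommRing S] (a b : ℕ) :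
    (-1 : S) ^ ((a : ℤ) - b).natAbs = (-1) ^ a * (-1) ^ b := by
  rw [← pow_add]
  apply neg_one_pow_congr
  grind

/-- A Cauchy product reindexed by p = b − j. Nonzero terms have −a ≤ p ≤ b, which the bounds on K
keep in range. -/
theorem sum_tens_hZ {a b K : ℕ} (ha : a ≤ K) (hb : b ≤ K) :
    ∑ p ∈ Finset.Icc (-K : ℤ) K, (-1) ^ p.natAbs * tens (hZ R (p + a)) (hZ R (-p + b))
      = (-1) ^ b * hDiff R (a + b) := by
  rw [hDiff_eq, Finset.mul_sum]
  symm
  refine Finset.sum_of_injOn (fun x : ℕ × ℕ => (b : ℤ) - x.2) ?_ ?_ ?_ ?_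
  · intro x hx y hy hxy
    simp only [Finset.mem_coe, Finset.HasAntidiagonal.mem_antidiagonal] at hx hy hxy
    ext <;> omega
  · intro x hx
    simp only [Finset.mem_coe, Finset.HasAntidiagonal.mem_antidiagonal, Finset.mem_Icc] at hx ⊢
    omega
  · intro p _ hp'
    by_cases h1 : p + a < 0
    · rw [hZ_of_neg R h1, map_zero, LinearMap.zero_apply, mul_zero]
    by_cases h2 : -p + b < 0
    · rw [hZ_of_neg R h2, map_zero, mul_zero]
    exfalso
    apply hp'
    refine ⟨((p + a).toNat, (-p + b).toNat), ?_, ?_⟩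
    · simp only [Finset.mem_coe, Finset.HasAntidiagonal.mem_antidiagonal]
      omega
    · simp only
      omega
  · intro x hx
    rw [Finset.HasAntidiagonal.mem_antidiagonal] at hx
    rw [neg_one_pow_natAbs_sub, ← mul_assoc, show (b : ℤ) - x.2 + a = x.1 by omega,
      show -((b : ℤ) - x.2) + b = x.2 by omega]

theorem residue_coe (f : MvPolynomial ℕ R) : ∃ K₀ : ℕ, ∀ K : ℕ, K₀ ≤ K →
    residue (f : MvPowerSeries ℕ R) = ((∑ p ∈ Finset.Icc (-K : ℤ) K,
      (-1) ^ p.natAbs * tens (vop R p f) (vop R (-p) f) : MvPolynomial (ℕ ⊕ ℕ) R) :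
        MvPowerSeries (ℕ ⊕ ℕ) R) := by
  classical
  set N := (shiftHom f).natDegree + 1 with hN
  -- The shifted polynomial has degree below N in k⁻¹, so φ_{−p} kills `f` for p ≥ N and the sum no
  -- longer depends on K.
  refine ⟨N, fun K hK => ?_⟩
  set D : ℕ → MvPolynomial ℕ R := fun a => (shiftHom f).coeff a with hD
  have hD0 : ∀ a, N ≤ a → D a = 0 := fun a ha =>
    Polynomial.coeff_eq_zero_of_natDegree_lt (by omega)
  let G : ℕ × ℕ → MvPolynomial (ℕ ⊕ ℕ) R := fun x =>
    (-1) ^ x.2 * tens (D x.1) (D x.2) * hDiff R (x.1 + x.2)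
  have hG0 : ∀ x : ℕ × ℕ, x ∉ Finset.range N ×ˢ Finset.range N → G x = 0 := by
    intro x hx
    simp only [Finset.mem_product, Finset.mem_range, not_and_or, not_lt] at hx
    rcases hx with hx | hx <;> simp [G, hD0 _ hx]
  have h1 : ∀ n, (hDiff R n : MvPowerSeries (ℕ ⊕ ℕ) R) * shiftedProductCoeff f n
      = ((∑ x ∈ Finset.HasAntidiagonal.antidiagonal n, G x : MvPolynomial (ℕ ⊕ ℕ) R) :
        MvPowerSeries (ℕ ⊕ ℕ) R) := by
    intro n
    rw [shiftedProductCoeff_coe, ← MvPolynomial.coe_mul, Finset.mul_sum]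
    congr 1
    refine Finset.sum_congr rfl fun x hx => ?_
    rw [Finset.HasAntidiagonal.mem_antidiagonal] at hx
    simp only [G, tens_apply, hx, hD]
    ring
  have h2 : residue (f : MvPowerSeries ℕ R) = ((∑ n ∈ Finset.range (2 * N),
      ∑ x ∈ Finset.HasAntidiagonal.antidiagonal n, G x : MvPolynomial (ℕ ⊕ ℕ) R) :
        MvPowerSeries (ℕ ⊕ ℕ) R) := by
    ext d
    change ∑ᶠ n : ℕ, _ = _
    rw [finsum_eq_sum_of_support_subset (s := Finset.range (2 * N))]
    · simp only [h1, MvPolynomial.coeff_coe, MvPolynomial.coeff_sum]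
    · intro n hn
      rw [Finset.mem_coe, Finset.mem_range]
      by_contra hlt
      refine hn ?_
      simp only [h1, MvPolynomial.coeff_coe]
      rw [Finset.sum_eq_zero, MvPolynomial.coeff_zero]
      intro x hx
      rw [Finset.HasAntidiagonal.mem_antidiagonal] at hx
      apply hG0
      simp only [Finset.mem_product, Finset.mem_range]
      omega
  have h3 : ∑ n ∈ Finset.range (2 * N), ∑ x ∈ Finset.HasAntidiagonal.antidiagonal n, G x
      = ∑ x ∈ Finset.range N ×ˢ Finset.range N, G x := by
    rw [← Finset.sum_fiberwise_of_maps_to (s := Finset.range N ×ˢ Finset.range N)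
      (t := Finset.range (2 * N)) (g := fun x => x.1 + x.2)]
    · refine Finset.sum_congr rfl fun n _ => (Finset.sum_subset ?_ ?_).symm
      · intro x hx
        rw [Finset.HasAntidiagonal.mem_antidiagonal]
        exact (Finset.mem_filter.mp hx).2
      · intro x hx hx'
        rw [Finset.HasAntidiagonal.mem_antidiagonal] at hx
        exact hG0 x fun h => hx' (Finset.mem_filter.mpr ⟨h, hx⟩)
    · intro x hx
      simp only [Finset.mem_product, Finset.mem_range] at hx ⊢
      omega
  have h4 : ∀ p : ℤ, vop R p f = ∑ a ∈ Finset.range N, D a * hZ R (p + a) := fun p =>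
    pairing_eq_sum R p (shiftHom f) (by omega)
  have h5 : ∑ p ∈ Finset.Icc (-K : ℤ) K, (-1) ^ p.natAbs * tens (vop R p f) (vop R (-p) f)
      = ∑ x ∈ Finset.range N ×ˢ Finset.range N, G x := by
    simp only [h4, map_sum, LinearMap.sum_apply, Finset.mul_sum]
    rw [Finset.sum_product, Finset.sum_comm]
    rw [Finset.sum_congr rfl fun a _ => Finset.sum_comm]
    rw [Finset.sum_comm]
    refine Finset.sum_congr rfl fun a ha => Finset.sum_congr rfl fun b hb => ?_
    rw [Finset.mem_range] at ha hb
    have h6 := sum_tens_hZ (R := R) (a := a) (b := b) (K := K) (by omega) (by omega)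
    simp only [G]
    rw [mul_right_comm, ← h6, Finset.sum_mul]
    refine Finset.sum_congr rfl fun p _ => ?_
    simp only [tens_apply, map_mul]
    ring
  rw [h2, h3, h5]

theorem sum_Icc_neg {S : Type*} [AddCommMonoid S] (F : ℤ → S) (K : ℕ) :
    ∑ p ∈ Finset.Icc (-K : ℤ) K, F p = F 0 + ∑ n ∈ Finset.Icc 1 K, (F n + F (-n)) := by
  induction K with
  | zero => simp
  | succ K ih =>
    have h1 : Finset.Icc (-(K + 1 : ℕ) : ℤ) (K + 1 : ℕ)
        = insert (-(K + 1 : ℕ) : ℤ) (insert ((K + 1 : ℕ) : ℤ) (Finset.Icc (-K : ℤ) K)) := by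
      ext x
      simp only [Finset.mem_Icc, Finset.mem_insert]
      omega
    rw [h1, Finset.sum_insert, Finset.sum_insert, ih, Finset.sum_Icc_succ_top (by omega)]
    · abel
    · simp
    · simp only [Finset.mem_Icc, Finset.mem_insert]
      omega

end Residue

/-! ### The bilinear identity in the basis of Q-polynomials -/

section Bilinear

variable {R : Type*} [CommRing R] [Algebra ℂ R]

/-- The sum `∑ c_λ Q_λ(t/2)` over the strict partitions with parts at most `M`. -/
def tauTrunc (M : ℕ) (c : Finset ℕ → R) : MvPolynomial ℕ R :=
  ∑ s ∈ (Finset.Icc 1 M).powerset, c s • halfQ R s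

theorem zero_notMem_of_mem {M : ℕ} {s : Finset ℕ} (hs : s ∈ (Finset.Icc 1 M).powerset) :
    0 ∉ s := fun h => by
  simpa using Finset.mem_powerset.mp hs h

theorem symmDiff_singleton_mem {M n : ℕ} (hn : n ∈ Finset.Icc 1 M) {s : Finset ℕ}
    (hs : s ∈ (Finset.Icc 1 M).powerset) : symmDiff s {n} ∈ (Finset.Icc 1 M).powerset := by
  rw [Finset.mem_powerset] at hs ⊢
  intro x hx
  rw [Finset.mem_symmDiff, Finset.mem_singleton] at hx
  rcases hx with hx | hx
  · exact hs hx.1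
  · rw [hx.1]; exact hn

theorem sum_symmDiff_singleton {S : Type*} [AddCommMonoid S] {M n : ℕ} (hn : n ∈ Finset.Icc 1 M)
    (F : Finset ℕ → S) : ∑ s ∈ (Finset.Icc 1 M).powerset, F (symmDiff s {n})
      = ∑ s ∈ (Finset.Icc 1 M).powerset, F s :=
  Finset.sum_nbij' (fun s => symmDiff s {n}) (fun s => symmDiff s {n})
    (fun _ hs => symmDiff_singleton_mem hn hs) (fun _ hs => symmDiff_singleton_mem hn hs)
    (fun _ _ => symmDiff_symmDiff_cancel_right _ _) (fun _ _ => symmDiff_symmDiff_cancel_right _ _)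
    (fun _ _ => rfl)

theorem sgn_symmDiff_singleton {R : Type*} [CommRing R] (n : ℕ) (s : Finset ℕ) :
    sgn R n (symmDiff s {n}) = sgn R n s := by
  rw [sgn_symmDiff]
  simp [sgn, Finset.filter_singleton]

/-- Reindexing by the involution s ↦ s ∆ {n} collects the result in the basis; n ≤ M keeps it among
the sets of parts at most M. -/
theorem vop_natCast_tauTrunc (c : Finset ℕ → R) {M n : ℕ} (hn : n ∈ Finset.Icc 1 M) :
    vop R n (tauTrunc M c) = ∑ s ∈ (Finset.Icc 1 M).powerset,
      (if n ∈ s then 2 * invSqrtTwo R * (sgn R n s * c (symmDiff s {n})) else 0) • halfQ R s := by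
  have hn0 : n ≠ 0 := by have := Finset.mem_Icc.mp hn; omega
  rw [tauTrunc, map_sum, ← sum_symmDiff_singleton hn]
  refine Finset.sum_congr rfl fun s hs => ?_
  rw [map_smul, vop_natCast_halfQ R hn0 (zero_notMem_of_mem (symmDiff_singleton_mem hn hs)),
    sgn_symmDiff_singleton]
  by_cases h : n ∈ s
  · rw [symmDiff_singleton_of_mem h, if_neg (Finset.notMem_erase n s), if_pos h,
      Finset.insert_erase h, smul_smul]
    congr 1
    ring
  · rw [symmDiff_singleton_of_notMem h, if_pos (Finset.mem_insert_self n s), if_neg h, smul_zero,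
      zero_smul]

theorem vop_neg_tauTrunc (c : Finset ℕ → R) {M n : ℕ} (hn : n ∈ Finset.Icc 1 M) :
    vop R (-n) (tauTrunc M c) = ∑ s ∈ (Finset.Icc 1 M).powerset,
      (if n ∈ s then 0 else 2 * invSqrtTwo R * ((-1) ^ n * sgn R n s * c (symmDiff s {n})))
        • halfQ R s := by
  have hn0 : n ≠ 0 := by have := Finset.mem_Icc.mp hn; omega
  rw [tauTrunc, map_sum, ← sum_symmDiff_singleton hn]
  refine Finset.sum_congr rfl fun s hs => ?_
  rw [map_smul, vop_neg_halfQ R hn0 (zero_notMem_of_mem (symmDiff_singleton_mem hn hs)),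
    sgn_symmDiff_singleton]
  by_cases h : n ∈ s
  · rw [symmDiff_singleton_of_mem h, if_neg (Finset.notMem_erase n s), if_pos h, smul_zero,
      zero_smul]
  · rw [symmDiff_singleton_of_notMem h, if_pos (Finset.mem_insert_self n s), if_neg h,
      Finset.erase_insert h, smul_smul]
    congr 1
    ring

theorem vop_neg_tauTrunc_of_lt (c : Finset ℕ → R) {M n : ℕ} (hn : M < n) :
    vop R (-n) (tauTrunc M c) = 0 := by
  rw [tauTrunc, map_sum]
  refine Finset.sum_eq_zero fun s hs => ?_
  rw [map_smul, vop_neg_halfQ R (by omega) (zero_notMem_of_mem hs), if_neg, smul_zero]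
  intro h
  have := Finset.mem_Icc.mp (Finset.mem_powerset.mp hs h)
  omega

theorem vop_zero_tauTrunc (c : Finset ℕ → R) (M : ℕ) :
    vop R 0 (tauTrunc M c) = ∑ s ∈ (Finset.Icc 1 M).powerset,
      ((-1) ^ s.card * c s) • halfQ R s := by
  rw [tauTrunc, map_sum]
  refine Finset.sum_congr rfl fun s hs => ?_
  rw [map_smul, vop_zero_halfQ R (zero_notMem_of_mem hs), smul_smul, mul_comm]

theorem tens_sum (U : Finset (Finset ℕ)) (a b : Finset ℕ → R) :
    tens (∑ s ∈ U, a s • halfQ R s) (∑ s ∈ U, b s • halfQ R s)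
      = ∑ x ∈ U ×ˢ U, (a x.1 * b x.2) • tens (halfQ R x.1) (halfQ R x.2) := by
  rw [Finset.sum_product, LinearMap.map_sum₂]
  refine Finset.sum_congr rfl fun s _ => ?_
  rw [map_sum]
  refine Finset.sum_congr rfl fun t _ => ?_
  rw [LinearMap.map_smul₂, map_smul, smul_smul]

/-- The coefficient of `Q_λ(t/2) Q_μ(t'/2)` in the bilinear identity for `∑ c_λ Q_λ(t/2)`. -/
def bilinCoeff (c : Finset ℕ → R) (s t : Finset ℕ) : R :=
  2 * plucker c s t + ((-1) ^ (s.card + t.card) - 1) * (c s * c t)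

/-- For 0 < n ≤ M the modes n and −n contribute on s \ t and t \ s, together giving the Plücker sum.
The mode 0 gives the parity sign. For n > M one factor of each term is annihilated. -/
theorem bilinear_tauTrunc (c : Finset ℕ → R) {M K : ℕ} (hMK : M ≤ K) :
    ∑ p ∈ Finset.Icc (-K : ℤ) K,
        (-1) ^ p.natAbs * tens (vop R p (tauTrunc M c)) (vop R (-p) (tauTrunc M c))
      = tens (tauTrunc M c) (tauTrunc M c)
        + ∑ x ∈ (Finset.Icc 1 M).powerset ×ˢ (Finset.Icc 1 M).powerset,
          bilinCoeff c x.1 x.2 • tens (halfQ R x.1) (halfQ R x.2) := by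
  set U := (Finset.Icc 1 M).powerset with hU
  have h1 : ∀ n ∈ Finset.Icc 1 M,
      (-1) ^ (n : ℤ).natAbs * tens (vop R n (tauTrunc M c)) (vop R (-n) (tauTrunc M c))
        + (-1) ^ (-n : ℤ).natAbs * tens (vop R (-n) (tauTrunc M c)) (vop R (- -n) (tauTrunc M c))
      = ∑ x ∈ U ×ˢ U, (if n ∈ symmDiff x.1 x.2 then 2 * (sgn R n (symmDiff x.1 x.2)
          * c (symmDiff x.1 {n}) * c (symmDiff x.2 {n})) else 0)
            • tens (halfQ R x.1) (halfQ R x.2) := by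
    intro n hn
    have h2 : ((-1) ^ n : MvPolynomial (ℕ ⊕ ℕ) R) = MvPolynomial.C ((-1) ^ n) := by simp
    rw [neg_neg, Int.natAbs_neg, Int.natAbs_natCast, h2, ← MvPolynomial.smul_eq_C_mul,
      ← MvPolynomial.smul_eq_C_mul, vop_natCast_tauTrunc c hn, vop_neg_tauTrunc c hn, tens_sum,
      tens_sum, Finset.smul_sum, Finset.smul_sum, ← Finset.sum_add_distrib]
    refine Finset.sum_congr rfl fun x _ => ?_
    rw [smul_smul, smul_smul, ← add_smul, sgn_symmDiff]
    congr 1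
    have h3 : ((-1 : R) ^ n) * (-1) ^ n = 1 := by rw [← mul_pow]; simp
    have h4 := two_mul_invSqrtTwo_sq R
    -- The factors √2 of one creation and one annihilation multiply to the 2 in front of the Plücker
    -- sum.
    have h5 : (-1 : R) ^ n * (2 * invSqrtTwo R) * (2 * invSqrtTwo R * (-1) ^ n) = 2 := by
      linear_combination (2 * invSqrtTwo R) * (2 * invSqrtTwo R) * h3 + 2 * h4
    simp only [Finset.mem_symmDiff]
    by_cases hs : n ∈ x.1 <;> by_cases ht : n ∈ x.2 <;> simp only [hs, ht, if_true, if_false,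
      not_true, not_false_eq_true, and_true, and_false, or_false, false_or,
      mul_zero, zero_mul, add_zero, zero_add]
    all_goals linear_combination (sgn R n x.1 * sgn R n x.2 * c (symmDiff x.1 {n})
      * c (symmDiff x.2 {n})) * h5
  rw [sum_Icc_neg]
  have h6 : Finset.Icc 1 M ⊆ Finset.Icc 1 K := Finset.Icc_subset_Icc_right hMK
  rw [← Finset.sum_subset h6]
  · rw [Finset.sum_congr rfl h1, Finset.sum_comm, neg_zero, vop_zero_tauTrunc, tens_sum,
      Int.natAbs_zero, pow_zero, one_mul]
    have h7 : tens (tauTrunc M c) (tauTrunc M c)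
        = ∑ x ∈ U ×ˢ U, (c x.1 * c x.2) • tens (halfQ R x.1) (halfQ R x.2) := tens_sum _ _ _
    rw [h7, ← Finset.sum_add_distrib, ← Finset.sum_add_distrib]
    refine Finset.sum_congr rfl fun x hx => ?_
    rw [← Finset.sum_smul, ← add_smul, ← add_smul]
    congr 1
    rw [← Finset.sum_filter, bilinCoeff, plucker, ← Finset.mul_sum]
    have h8 : (Finset.Icc 1 M).filter (· ∈ symmDiff x.1 x.2) = symmDiff x.1 x.2 := by
      rw [Finset.filter_mem_eq_inter, Finset.inter_eq_right]
      rw [Finset.mem_product, hU, Finset.mem_powerset, Finset.mem_powerset] at hx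
      intro y hy
      rcases Finset.mem_symmDiff.mp hy with h | h
      · exact hx.1 h.1
      · exact hx.2 h.1
    rw [h8, pow_add]
    ring
  · intro n hn hn'
    have h7 : M < n := by
      simp only [Finset.mem_Icc, not_and, not_le] at hn hn'
      exact hn' hn.1
    rw [vop_neg_tauTrunc_of_lt c h7]
    simp

/-! ### Linear independence of the products -/

theorem map_C_halfQ (s : Finset ℕ) :
    MvPolynomial.map (MvPolynomial.C : R →+* MvPolynomial ℕ R) (halfQ R s)
      = halfQ (MvPolynomial ℕ R) s := by
  let φ : MvPolynomial ℕ R →ₐ[ℂ] MvPolynomial ℕ (MvPolynomial ℕ R) :=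
    MvPolynomial.mapAlgHom (IsScalarTower.toAlgHom ℂ R (MvPolynomial ℕ R))
  change φ (MvPolynomial.aeval _ _) = MvPolynomial.aeval _ _
  rw [← AlgHom.comp_apply]
  congr 1
  ext1 i
  simp [φ, IsScalarTower.algebraMap_apply ℂ R (MvPolynomial ℕ R)]

theorem sumAlgEquiv_tens {R : Type*} [CommRing R] (f g : MvPolynomial ℕ R) :
    MvPolynomial.sumAlgEquiv R ℕ ℕ (tens f g)
      = MvPolynomial.C g * MvPolynomial.map MvPolynomial.C f := by
  rw [tens_apply, map_mul, mul_comm]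
  congr 1
  · exact DFunLike.congr_fun (MvPolynomial.sumAlgEquiv_comp_rename_inr R ℕ ℕ) g
  · exact DFunLike.congr_fun (MvPolynomial.sumAlgEquiv_comp_rename_inl R ℕ ℕ) f

/-- Independence is used twice: first in t with coefficients polynomial in t', then in t' over R. -/
theorem tens_halfQ_linearIndependent {M : ℕ} {κ : Finset ℕ → Finset ℕ → R}
    (h : ∑ x ∈ (Finset.Icc 1 M).powerset ×ˢ (Finset.Icc 1 M).powerset,
      κ x.1 x.2 • tens (halfQ R x.1) (halfQ R x.2) = 0) :
    ∀ s ∈ (Finset.Icc 1 M).powerset, ∀ t ∈ (Finset.Icc 1 M).powerset, κ s t = 0 := by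
  have h1 := congrArg (MvPolynomial.sumAlgEquiv R ℕ ℕ) h
  rw [Finset.sum_product, map_sum, map_zero] at h1
  have h2 := halfQ_linearIndependent (MvPolynomial ℕ R) M
    (fun s => ∑ t ∈ (Finset.Icc 1 M).powerset, κ s t • halfQ R t) (by
      rw [← h1]
      refine Finset.sum_congr rfl fun s _ => ?_
      rw [map_sum, Finset.sum_smul]
      refine Finset.sum_congr rfl fun t _ => ?_
      rw [map_smul, sumAlgEquiv_tens, map_C_halfQ, ← MvPolynomial.smul_eq_C_mul, smul_assoc])
  intro s hs
  exact halfQ_linearIndependent R M _ (h2 s hs)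

theorem tens_halfQ_homog {s t : Finset ℕ} (hs : 0 ∉ s) (ht : 0 ∉ t) :
    MvPolynomial.IsWeightedHomogeneous (Sum.elim wt wt) (tens (halfQ R s) (halfQ R t))
      (∑ i ∈ s, i + ∑ i ∈ t, i) := by
  have key : ∀ (e : ℕ → ℕ ⊕ ℕ) (_ : ∀ i, Sum.elim wt wt (e i) = wt i) {s : Finset ℕ} (_ : 0 ∉ s),
      MvPolynomial.IsWeightedHomogeneous (Sum.elim wt wt) (MvPolynomial.rename e (halfQ R s))
        (∑ i ∈ s, i) := by
    intro e he s hs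
    have h1 : MvPolynomial.rename e (halfQ R s) = MvPolynomial.aeval
        (fun i => MvPolynomial.C (algebraMap ℂ R (1 / 2)) * MvPolynomial.X (e i)) (Q (drop0 s)) := by
      change ((MvPolynomial.rename e : _ →ₐ[R] _).restrictScalars ℂ) (MvPolynomial.aeval _ _) = _
      rw [← AlgHom.comp_apply]
      congr 1
      ext1 i
      simp
    have h2 : (drop0 s).size = ∑ i ∈ s, i := by
      change ∑ i ∈ s.erase 0, i = _
      rw [Finset.erase_eq_of_notMem hs]
    rw [h1, ← h2]
    refine aeval_homog _ _ (fun i => ?_) (Q_homog _)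
    rw [← he i]
    exact (MvPolynomial.isWeightedHomogeneous_X R _ (e i)).C_mul _
  exact (key Sum.inl (fun _ => rfl) hs).mul (key Sum.inr (fun _ => rfl) ht)

end Bilinear

/-! ### From the bilinear coefficients to the Plücker relations and the hierarchy -/

section Main

variable {R : Type*} [CommRing R]

theorem plucker_comm (c : Finset ℕ → R) (s t : Finset ℕ) : plucker c s t = plucker c t s := by
  rw [plucker, plucker, symmDiff_comm]
  exact Finset.sum_congr rfl fun i _ => by ring

theorem drop0_symmDiff_zero_symmDiff (s : Finset ℕ) (i : ℕ) :
    drop0 (symmDiff (symmDiff s {0}) {i}) = drop0 (symmDiff s {i}) := by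
  rw [symmDiff_right_comm, drop0_symmDiff_zero]

/-- The new element 0 lies below all others, so its term has sign (−1)^{|s|+|t|} = −1 and equals
−C_s C_t. -/
theorem plucker_toggle_zero_right (C : StrictPartition → R) {s t : Finset ℕ} (hs : 0 ∉ s)
    (ht : 0 ∉ t) (hst : Odd (s.card + t.card)) :
    plucker (fun s => C (drop0 s)) s (symmDiff t {0})
      = plucker (fun s => C (drop0 s)) s t - C (drop0 s) * C (drop0 t) := by
  have h0 : 0 ∉ symmDiff s t := by simp [Finset.mem_symmDiff, hs, ht]
  have h1 : symmDiff s (symmDiff t {0}) = insert 0 (symmDiff s t) := by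
    rw [← symmDiff_assoc, symmDiff_singleton_of_notMem h0]
  have h2 : ∀ n, sgn R n (insert 0 (symmDiff s t)) = sgn R n (symmDiff s t) := fun n => by
    rw [sgn, sgn, Finset.filter_insert, if_neg (Nat.not_lt_zero n)]
  have h3 : sgn R 0 (symmDiff s t) = -1 := by
    have h4 : ∀ u : Finset ℕ, 0 ∉ u → u.filter (0 < ·) = u := fun u hu =>
      Finset.filter_true_of_mem fun x hx => Nat.pos_of_ne_zero fun h => hu (h ▸ hx)
    rw [sgn_symmDiff, sgn, sgn, h4 s hs, h4 t ht, ← pow_add, hst.neg_one_pow]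
  rw [plucker, h1, Finset.sum_insert h0, h2, h3]
  simp only [h2, drop0_symmDiff_zero_symmDiff, drop0_symmDiff_zero, symmDiff_symmDiff_cancel_right]
  rw [plucker]
  ring

/-- The set of odd cardinality that differs from `s` at most in the element `0`. -/
def oddify (s : Finset ℕ) : Finset ℕ := if Odd s.card then s else symmDiff s {0}

theorem odd_card_oddify {s : Finset ℕ} (hs : 0 ∉ s) : Odd (oddify s).card := by
  rw [oddify]
  split_ifs with h
  · exact h
  · rw [symmDiff_singleton_of_notMem hs, Finset.card_insert_of_notMem hs]
    exact (Nat.not_odd_iff_even.mp h).add_one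

theorem oddify_drop0 {s : Finset ℕ} (hs : Odd s.card) : oddify (drop0 s).1 = s := by
  change oddify (s.erase 0) = s
  by_cases h : 0 ∈ s
  · have h1 := Finset.card_erase_add_one h
    rw [oddify, if_neg (by grind), symmDiff_singleton_of_notMem (Finset.notMem_erase 0 s),
      Finset.insert_erase h]
  · rw [Finset.erase_eq_of_notMem h, oddify, if_pos hs]

/-- When s and t differ in parity, the correction −2 C_s C_t in `bilinCoeff` is exactly the term
created by adjoining 0 to the even one. -/
theorem bilinCoeff_eq (C : StrictPartition → R) {s t : Finset ℕ} (hs : 0 ∉ s) (ht : 0 ∉ t) :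
    bilinCoeff (fun s => C (drop0 s)) s t
      = 2 * plucker (fun s => C (drop0 s)) (oddify s) (oddify t) := by
  rw [bilinCoeff, oddify, oddify]
  split_ifs with h1 h2 h2
  · rw [(h1.add_odd h2).neg_one_pow]; ring
  · have h3 : Odd (s.card + t.card) := h1.add_even (Nat.not_odd_iff_even.mp h2)
    rw [plucker_toggle_zero_right C hs ht h3, h3.neg_one_pow]; ring
  · have h3 : Odd (s.card + t.card) := (Nat.not_odd_iff_even.mp h1).add_odd h2
    rw [plucker_comm _ (symmDiff s {0}), plucker_toggle_zero_right C ht hs (by rwa [add_comm]),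
      h3.neg_one_pow, plucker_comm _ t]
    ring
  · rw [plucker_toggle_zero, ((Nat.not_odd_iff_even.mp h1).add
      (Nat.not_odd_iff_even.mp h2)).neg_one_pow]
    ring

variable [Algebra ℂ R]

theorem pluckerRelations_iff_bilinCoeff {C : StrictPartition → R} : PluckerRelations C ↔
    ∀ s t : Finset ℕ, 0 ∉ s → 0 ∉ t → bilinCoeff (fun s => C (drop0 s)) s t = 0 := by
  rw [pluckerRelations_iff]
  constructor
  · intro h s t hs ht
    rw [bilinCoeff_eq C hs ht, h _ _ (odd_card_oddify hs) (odd_card_oddify ht), mul_zero]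
  · intro h A B hA hB
    have h1 := h (drop0 A).1 (drop0 B).1 (drop0 A).2 (drop0 B).2
    rw [bilinCoeff_eq C (drop0 A).2 (drop0 B).2, oddify_drop0 hA, oddify_drop0 hB] at h1
    exact (isUnit_two R).mul_right_eq_zero.mp h1

/-- A monomial of weight at most M occurs only in Q_λ with |λ| ≤ M, and then all parts are at most
M. -/
theorem agreeTo_tauSeries (C : StrictPartition → R) (M : ℕ) :
    AgreeTo wt M (tauSeries (algebraMap ℂ R (1 / 2)) C)
      (tauTrunc M (fun s => C (drop0 s)) : MvPolynomial ℕ R) := by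
  classical
  intro d hd
  have h1 : Set.InjOn drop0 ((Finset.Icc 1 M).powerset : Set (Finset ℕ)) := by
    intro s hs t ht hst
    have h2 := congrArg Subtype.val hst
    simp only [drop0] at h2
    rwa [Finset.erase_eq_of_notMem (zero_notMem_of_mem hs),
      Finset.erase_eq_of_notMem (zero_notMem_of_mem ht)] at h2
  change ∑ᶠ l : StrictPartition, _ = _
  rw [finsum_eq_sum_of_support_subset (s := (Finset.Icc 1 M).powerset.image drop0),
    Finset.sum_image h1, MvPolynomial.coeff_coe, tauTrunc, MvPolynomial.coeff_sum]
  · rfl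
  · intro l hl
    have h2 : MvPolynomial.IsWeightedHomogeneous wt (Qat (algebraMap ℂ R (1 / 2)) l) l.size :=
      aeval_homog wt _ (fun i => (MvPolynomial.isWeightedHomogeneous_X R wt i).C_mul _) (Q_homog l)
    have h3 : (Qat (algebraMap ℂ R (1 / 2)) l).coeff d ≠ 0 := fun h0 => hl (by simp only [h0, mul_zero])
    have h4 : l.size ≤ M := (h2 h3).symm.le.trans hd
    rw [Finset.mem_coe, Finset.mem_image]
    refine ⟨l.1, Finset.mem_powerset.mpr fun i hi => ?_, drop0_self l⟩
    rw [Finset.mem_Icc]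
    refine ⟨Nat.pos_of_ne_zero fun h => l.2 (h ▸ hi), le_trans ?_ h4⟩
    exact Finset.single_le_sum (f := fun j => j) (fun _ _ => Nat.zero_le _) hi

theorem coeff_residue_tauSeries (C : StrictPartition → R) {M : ℕ} {d : ℕ ⊕ ℕ →₀ ℕ}
    (hd : Finsupp.weight (Sum.elim wt wt) d ≤ M) :
    (residue (tauSeries (algebraMap ℂ R (1 / 2)) C)).coeff d =
      (MvPowerSeries.rename (Function.Embedding.inl : ℕ ↪ ℕ ⊕ ℕ)
          (tauSeries (algebraMap ℂ R (1 / 2)) C)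
        * MvPowerSeries.rename (Function.Embedding.inr : ℕ ↪ ℕ ⊕ ℕ)
          (tauSeries (algebraMap ℂ R (1 / 2)) C)).coeff d +
      (∑ x ∈ (Finset.Icc 1 M).powerset ×ˢ (Finset.Icc 1 M).powerset,
          bilinCoeff (fun s => C (drop0 s)) x.1 x.2 • tens (halfQ R x.1) (halfQ R x.2)).coeff d := by
  have h1 := agreeTo_tauSeries C M
  obtain ⟨K, hK⟩ := residue_coe (tauTrunc M (fun s => C (drop0 s)))
  have h2 := (h1.rename (w' := Sum.elim wt wt) (Function.Embedding.inl : ℕ ↪ ℕ ⊕ ℕ)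
    (fun _ => rfl)).mul (h1.rename (Function.Embedding.inr : ℕ ↪ ℕ ⊕ ℕ) (fun _ => rfl))
  rw [h1.residue d hd, h2 d hd, hK (max K M) (le_max_left _ _),
    bilinear_tauTrunc _ (le_max_right _ _), MvPowerSeries.rename_coe, MvPowerSeries.rename_coe,
    ← MvPolynomial.coe_mul, MvPolynomial.coeff_coe, MvPolynomial.coeff_coe, MvPolynomial.coeff_add]
  rfl

theorem isBKP_tauSeries_iff (C : StrictPartition → R) :
    IsBKP (tauSeries (algebraMap ℂ R (1 / 2)) C) ↔ PluckerRelations C := by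
  rw [pluckerRelations_iff_bilinCoeff]
  constructor
  · intro h s t hs ht
    set N := ∑ i ∈ s, i + ∑ i ∈ t, i with hN
    have hmem : ∀ u : Finset ℕ, 0 ∉ u → ∑ i ∈ u, i ≤ N → u ∈ (Finset.Icc 1 N).powerset := by
      intro u hu huN
      refine Finset.mem_powerset.mpr fun i hi => Finset.mem_Icc.mpr
        ⟨Nat.pos_of_ne_zero fun h => hu (h ▸ hi), le_trans ?_ huN⟩
      exact Finset.single_le_sum (f := fun j => j) (fun _ _ => Nat.zero_le _) hi
    -- The truncation also contains products of weight above N, about which it says nothing.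
    -- Restricting κ to total weight N keeps only coefficients that the hierarchy controls.
    have h1 := tens_halfQ_linearIndependent (R := R) (M := N) (κ := fun s t =>
      if ∑ i ∈ s, i + ∑ i ∈ t, i = N then bilinCoeff (fun s => C (drop0 s)) s t else 0) (by
        ext d
        have key : ∀ x ∈ (Finset.Icc 1 N).powerset ×ˢ (Finset.Icc 1 N).powerset,
            ∑ i ∈ x.1, i + ∑ i ∈ x.2, i ≠ Finsupp.weight (Sum.elim wt wt) d →
            (tens (halfQ R x.1) (halfQ R x.2)).coeff d = 0 := fun x hx hxd => by
          rw [Finset.mem_product] at hx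
          by_contra h0
          exact hxd (tens_halfQ_homog (zero_notMem_of_mem hx.1) (zero_notMem_of_mem hx.2) h0).symm
        rw [MvPolynomial.coeff_zero, MvPolynomial.coeff_sum]
        by_cases hd : Finsupp.weight (Sum.elim wt wt) d = N
        · have h2 := coeff_residue_tauSeries C hd.le
          rw [h, left_eq_add, MvPolynomial.coeff_sum] at h2
          rw [← h2]
          refine Finset.sum_congr rfl fun x hx => ?_
          rw [MvPolynomial.coeff_smul, MvPolynomial.coeff_smul]
          split_ifs with hxN
          · rfl
          · rw [key x hx (by rwa [hd]), smul_zero, smul_zero]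
        · refine Finset.sum_eq_zero fun x hx => ?_
          rw [MvPolynomial.coeff_smul]
          split_ifs with hxN
          · rw [key x hx (by rw [hxN]; exact Ne.symm hd), smul_zero]
          · rw [zero_smul]) s (hmem s hs (by omega)) t (hmem t ht (by omega))
    simpa [← hN] using h1
  · intro h
    ext d
    rw [coeff_residue_tauSeries C le_rfl, Finset.sum_eq_zero, MvPolynomial.coeff_zero, add_zero]
    intro x hx
    rw [Finset.mem_product] at hx
    rw [h _ _ (zero_notMem_of_mem hx.1) (zero_notMem_of_mem hx.2), zero_smul]

/-- All times scale by the same factor, so a monomial scales by its ordinary degree rather than its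
weight, and the powers of ħ and ħ⁻¹ cancel. -/
theorem rescale_tauHbar (ħ : Rˣ) (C : StrictPartition → R) :
    MvPowerSeries.rescale (fun _ => (ħ : R)) (tauHbar ħ C)
      = tauSeries (algebraMap ℂ R (1 / 2)) C := by
  have h1 : ∀ (l : StrictPartition) (c : R), Qat c l = MvPolynomial.aeval
      (fun i => MvPolynomial.C c * MvPolynomial.X i) (MvPolynomial.map (algebraMap ℂ R) (Q l)) := by
    intro l c
    rw [MvPolynomial.aeval_map_algebraMap]
    rfl
  have h2 : ∀ (c : R) (p : MvPolynomial ℕ R) (d : ℕ →₀ ℕ), (MvPolynomial.aeval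
      (fun i => MvPolynomial.C c * MvPolynomial.X i) p : MvPolynomial ℕ R).coeff d
        = c ^ d.degree * p.coeff d := by
    classical
    intro c p d
    induction p using MvPolynomial.induction_on' with
    | add p q hp hq => rw [map_add, MvPolynomial.coeff_add, hp, hq, MvPolynomial.coeff_add, mul_add]
    | monomial e r =>
      have h3 : MvPolynomial.aeval (fun i => MvPolynomial.C c * MvPolynomial.X i)
          (MvPolynomial.monomial e r) = MvPolynomial.monomial e (c ^ e.degree * r) := by
        rw [MvPolynomial.aeval_monomial, Finsupp.prod]
        simp only [mul_pow, Finset.prod_mul_distrib, Finset.prod_pow_eq_pow_sum]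
        rw [Finsupp.degree_apply, MvPolynomial.algebraMap_eq, mul_comm (c ^ _), ← mul_assoc,
          MvPolynomial.monomial_eq, map_mul, map_pow]
        rfl
      rw [h3, MvPolynomial.coeff_monomial, MvPolynomial.coeff_monomial]
      split_ifs with h
      · rw [h]
      · rw [mul_zero]
  ext d
  rw [MvPowerSeries.coeff_rescale]
  change _ * (∑ᶠ l : StrictPartition, _) = ∑ᶠ l : StrictPartition, _
  rw [mul_finsum' _ _ (finite_support_tauSeries _ C d)]
  refine finsum_congr fun l => ?_
  rw [h1, h1, h2, h2, Finsupp.prod, Finset.prod_pow_eq_pow_sum, mul_pow, Finsupp.degree_apply]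
  have h3 : (ħ : R) ^ (∑ i ∈ d.support, d i) * ((ħ⁻¹ : Rˣ) : R) ^ (∑ i ∈ d.support, d i) = 1 := by
    rw [← mul_pow, Units.mul_inv, one_pow]
  linear_combination (C l * algebraMap ℂ R (1 / 2) ^ (∑ i ∈ d.support, d i)
    * (MvPolynomial.map (algebraMap ℂ R) (Q l)).coeff d) * h3

theorem isHbarBKP_tauHbar_iff (ħ : Rˣ) (C : StrictPartition → R) :
    IsHbarBKP ħ (tauHbar ħ C) ↔ PluckerRelations C := by
  rw [IsHbarBKP, rescale_tauHbar, isBKP_tauSeries_iff]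

end Main

end BKP

end

theorem mainTheorem1 {R : Type*} [CommRing R] [Algebra ℂ R] (ħ : Rˣ)
    (C : BKP.StrictPartition → R) :
    (BKP.IsHbarBKP ħ (BKP.tauHbar ħ C) ↔ BKP.PluckerRelations C) ∧
    (BKP.IsHbarBKP ħ (BKP.tauHbar ħ C) → BKP.FourTermRelations C) ∧
    ((∀ l, C l ∈ nonZeroDivisors R) →
      (BKP.IsHbarBKP ħ (BKP.tauHbar ħ C) ↔ BKP.FourTermRelations C)) := by
  rw [BKP.isHbarBKP_tauHbar_iff]
  exact ⟨Iff.rfl, BKP.fourTerm_of_plucker, fun hC =>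
    ⟨BKP.fourTerm_of_plucker, BKP.plucker_of_fourTerm hC⟩⟩
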